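/- Let $d\ge 1$ be an integer and let $V:\mathbb Z^d\to\mathbb R$. On $\ell^2(\mathbb Z^d)$ (complex-valued functions) consider the discrete Schrödinger operator $H_V=-\Delta+V$, where $$(-\Delta\psi)_n=\sum_{j=1}^d\bigl[(\psi_n-\psi_{n+\delta_j})+(\psi_n-\psi_{n-\delta_j})\bigr],$$ $\delta_1,\dots,\delta_d$ are the standard unit vectors, and $V$ acts by multiplication, on the maximal domain $\{\psi\in\ell^2(\mathbb Z^d) : V\psi\in\ell^2(\mathbb Z^d)\}$. Write $\sigma(H_V)$ for the spectrum of $H_V$, $\sigma_{\rm p}(H_V)$ for its set of eigenvalues, $|n|$ for the Euclidean norm of $n\in\mathbb Z^d$, and let $\log_0x=x$, $\log_{k+1}x=\log(\log_kx)$. If there exists an integer $s\ge 0$ such that $$V_n\ \ge\ 2d-\sum_{j=1}^{d}\left[\left(\frac{|n|}{|n+\delta_j|}\right)^{d/2}\prod_{i=1}^{s}\sqrt{\frac{\log_i|n|}{\log_i|n+\delta_j|}}+\left(\frac{|n|}{|n-\delta_j|}\right)^{d/2}\prod_{i=1}^{s}\sqrt{\frac{\log_i|n|}{\log_i|n-\delta_j|}}\right]$$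 for all $n\in\mathbb Z^d$ with $|n|$ sufficiently large, then $4d\notin\sigma_{\rm p}(H_V)$ or $4d\ne\sup\sigma(H_V)$. In particular, the same conclusion holds if there exists an integer $s\ge 0$ such that $$V_n\ \ge\ -\frac{d(4-d)}{4|n|^2}-\frac1{|n|^2}\sum_{j=1}^{s}\prod_{k=1}^{j}\frac1{\log_k|n|}$$ for all $n\in\mathbb Z^d$ with $|n|$ sufficiently large. -/

import Mathlib

/-- The Euclidean norm of a lattice point `n ∈ ℤ^d`. -/
noncomputable def latticeNorm {d : ℕ} (n : Fin d → ℤ) : ℝ :=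
  Real.sqrt (∑ j, (n j : ℝ) ^ 2)

/-- The iterated logarithm: `iterLog 0 x = x`, `iterLog (k + 1) x = log (iterLog k x)`. -/
noncomputable def iterLog : ℕ → ℝ → ℝ
  | 0, x => x
  | k + 1, x => Real.log (iterLog k x)

/-- The complex Hilbert space `ℓ²(ℤ^d)`. -/
abbrev LatticeL2 (d : ℕ) : Type := lp (fun _ : Fin d → ℤ => ℂ) 2

/-- The discrete Laplacian `-Δ` on functions: the sum of `ψ n - ψ m` over the `2d` nearest
neighbours `m = n ± δ_j` of `n`. -/
def negLaplacian {d : ℕ} (ψ : (Fin d → ℤ) → ℂ) (n : Fin d → ℤ) : ℂ :=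
  ∑ j : Fin d, ((ψ n - ψ (n + Pi.single j 1)) + (ψ n - ψ (n - Pi.single j 1)))

theorem memℓp_comp_equiv {d : ℕ} (e : (Fin d → ℤ) ≃ (Fin d → ℤ)) {ψ : (Fin d → ℤ) → ℂ}
    (h : Memℓp (E := fun _ : Fin d → ℤ => ℂ) ψ 2) :
    Memℓp (E := fun _ : Fin d → ℤ => ℂ) (fun n => ψ (e n)) 2 := by
  have h2 : 0 < (2 : ENNReal).toReal := by norm_num
  rw [memℓp_gen_iff h2] at h ⊢
  exact (e.summable_iff (f := fun n => ‖ψ n‖ ^ (2 : ENNReal).toReal)).2 h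

theorem memℓp_negLaplacian {d : ℕ} {ψ : (Fin d → ℤ) → ℂ}
    (h : Memℓp (E := fun _ : Fin d → ℤ => ℂ) ψ 2) :
    Memℓp (E := fun _ : Fin d → ℤ => ℂ) (negLaplacian ψ) 2 := by
  have h1 : ∀ j ∈ (Finset.univ : Finset (Fin d)),
      Memℓp (E := fun _ : Fin d → ℤ => ℂ)
        (fun n => (ψ n - ψ (n + Pi.single j 1)) + (ψ n - ψ (n - Pi.single j 1))) 2 := by
    intro j _
    exact (h.sub (memℓp_comp_equiv (Equiv.addRight (Pi.single j 1)) h)).add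
      (h.sub (memℓp_comp_equiv (Equiv.subRight (Pi.single j 1)) h))
  exact Memℓp.finsetSum Finset.univ h1

/-- The discrete Schrödinger operator `H_V = -Δ + V` in `ℓ²(ℤ^d)` with the maximal domain
`{ψ ∈ ℓ²(ℤ^d) | V ψ ∈ ℓ²(ℤ^d)}`. -/
noncomputable def schrodinger {d : ℕ} (V : (Fin d → ℤ) → ℝ) :
    LatticeL2 d →ₗ.[ℂ] LatticeL2 d where
  domain :=
    { carrier := {ψ | Memℓp (E := fun _ : Fin d → ℤ => ℂ) (fun n => (V n : ℂ) * ψ n) 2}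
      zero_mem' := by
        have h : Memℓp (E := fun _ : Fin d → ℤ => ℂ) 0 2 := zero_memℓp
        have h' : (fun n => (V n : ℂ) * (0 : LatticeL2 d) n) = 0 := by
          funext n
          simp
        exact (congrArg (fun f => Memℓp (E := fun _ : Fin d → ℤ => ℂ) f 2) h').mpr h
      add_mem' := by
        intro φ ψ hφ hψ
        have h := Memℓp.add hφ hψ
        have h' : (fun n => (V n : ℂ) * (φ + ψ) n) =
            (fun n => (V n : ℂ) * φ n) + fun n => (V n : ℂ) * ψ n := by
          funext n
          simp [mul_add]
        exact (congrArg (fun f => Memℓp (E := fun _ : Fin d → ℤ => ℂ) f 2) h').mpr h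
      smul_mem' := by
        intro c ψ hψ
        have h := Memℓp.const_smul hψ c
        have h' : (fun n => (V n : ℂ) * (c • ψ) n) = c • fun n => (V n : ℂ) * ψ n := by
          funext n
          simp [mul_left_comm]
        exact (congrArg (fun f => Memℓp (E := fun _ : Fin d → ℤ => ℂ) f 2) h').mpr h }
  toFun :=
    { toFun := fun ψ =>
        ⟨fun n => negLaplacian (ψ : LatticeL2 d) n + (V n : ℂ) * (ψ : LatticeL2 d) n,
          (memℓp_negLaplacian (lp.memℓp (ψ : LatticeL2 d))).add ψ.2⟩
      map_add' := by
        intro φ ψ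
        ext n
        simp only [negLaplacian, Submodule.coe_add, lp.coeFn_add, Pi.add_apply,
          Finset.sum_add_distrib, Finset.sum_sub_distrib]
        ring
      map_smul' := by
        intro c ψ
        ext n
        simp only [negLaplacian, Submodule.coe_smul, lp.coeFn_smul, Pi.smul_apply, smul_eq_mul,
          RingHom.id_apply, mul_add, Finset.mul_sum, mul_sub]
        ring_nf }

/-- The resolvent set of a possibly unbounded operator `T`: those `z` for which
`T - z : Dom T → H` is a bijection with bounded inverse. -/
def LinearPMap.resolventSet {H : Type*} [NormedAddCommGroup H] [NormedSpace ℂ H]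
    (T : H →ₗ.[ℂ] H) : Set ℂ :=
  {z | ∃ R : H →L[ℂ] H,
    (∀ y : H, ∃ h : R y ∈ T.domain, T ⟨R y, h⟩ - z • R y = y) ∧
    ∀ x : T.domain, R (T x - z • (x : H)) = x}

/-- The spectrum of a possibly unbounded operator. -/
def LinearPMap.spectrum {H : Type*} [NormedAddCommGroup H] [NormedSpace ℂ H]
    (T : H →ₗ.[ℂ] H) : Set ℂ :=
  (LinearPMap.resolventSet T)ᶜ

/-- The point spectrum (set of eigenvalues) of a possibly unbounded operator. -/
def LinearPMap.pointSpectrum {H : Type*} [NormedAddCommGroup H] [NormedSpace ℂ H]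
    (T : H →ₗ.[ℂ] H) : Set ℂ :=
  {z | ∃ x : T.domain, (x : H) ≠ 0 ∧ T x = z • (x : H)}

/-- The quotient `(|n| / |m|)^(d/2) ∏_{i=1}^s √(log_i |n| / log_i |m|)`. -/
noncomputable def comparisonRatio {d : ℕ} (s : ℕ) (n m : Fin d → ℤ) : ℝ :=
  (latticeNorm n / latticeNorm m) ^ ((d : ℝ) / 2) *
    ∏ i ∈ Finset.Icc 1 s, Real.sqrt (iterLog i (latticeNorm n) / iterLog i (latticeNorm m))

open Filter Topology
open scoped InnerProductSpace

/-! Suppose `4d` is both an eigenvalue and the supremum of the spectrum. Then the form of `4d - H_V`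
is nonnegative on the domain. Conjugation by the sign `(-1)^(n₁ + ⋯ + n_d)` turns `4d - H_V` into
`(2d - V) - N`, where `N` is the neighbour sum. Since `N` preserves positivity, the modulus `v` of
an eigenfunction also minimises the form, so `N v = (2d - V) v` (`neighborSum_norm_eigenfunction`),
and `v > 0` everywhere because a zero would propagate along edges.

The function `φ = |n|^(-d/2) ∏ (log_i |n|)^(-1/2)` is a subsolution far out: this is exactly the
hypothesis on `V`. It just fails to be square summable, yet `φ² ≤ |n|^(-d)` still allows cutoffs
whose energy with edge weights `φ n * φ m` tends to zero. A Liouville argument for `(c φ - v)₊ / v`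
(`caccioppoli`, `mul_le_of_subsolution`) then gives `c φ ≤ v` for some `c > 0`, which contradicts `v
∈ ℓ²`.

The explicit bound reduces to the first with one more logarithm. Concavity of the iterated
logarithms and a cubic Taylor bound estimate the ratios; the extra logarithm leaves a surplus of
order at least `1 / (|n| log |n|)²`, which absorbs the remainder `O(|n|⁻⁴)`. -/

/-! ### Quadratic forms bounded by the spectrum -/

theorem resolvent_identity {H : Type*} [NormedAddCommGroup H] [NormedSpace ℂ H]
    {T : H →ₗ.[ℂ] H} {z w : ℂ} {R S : H →L[ℂ] H}
    (hR : ∀ x : T.domain, R (T x - z • (x : H)) = x)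
    (hS : ∀ y : H, ∃ h : S y ∈ T.domain, T ⟨S y, h⟩ - w • S y = y) :
    S - R = (w - z) • (R * S) := by
  ext y
  obtain ⟨h, e⟩ := hS y
  have h1 := hR ⟨S y, h⟩
  have h2 : T ⟨S y, h⟩ - z • S y = y + (w - z) • S y := by
    rw [← sub_add_cancel (T ⟨S y, h⟩) (w • S y), e]
    module
  rw [h2, map_add, map_smul] at h1
  simp only [sub_apply, smul_apply, mul_apply_eq_comp]
  rw [sub_eq_iff_eq_add', h1]

/-- For real `z > M` the resolvent `R` at `z` is bounded and self-adjoint, and `-R` has nonnegative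
spectrum. Hence `-R ≥ 0`, and its form at `(T - z) x` is minus the form of `T - z` at `x`. Then `z`
decreases to `M`. Only the bounded operator needs a spectral theorem. -/
theorem re_inner_le_of_mem_upperBounds_spectrum {H : Type*} [NormedAddCommGroup H]
    [InnerProductSpace ℂ H] [CompleteSpace H] {T : H →ₗ.[ℂ] H}
    (hT : ∀ x y : T.domain, ⟪T x, (y : H)⟫_ℂ = ⟪(x : H), T y⟫_ℂ) {M : ℝ}
    (hM : M ∈ upperBounds {x : ℝ | (x : ℂ) ∈ T.spectrum}) (x : T.domain) :
    (⟪T x, (x : H)⟫_ℂ).re ≤ M * ‖(x : H)‖ ^ 2 := by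
  have hres : ∀ z : ℝ, M < z → (z : ℂ) ∈ T.resolventSet := by
    intro z hz
    by_contra h
    exact absurd (hM h) (not_le.2 hz)
  have key : ∀ z : ℝ, M < z → (⟪T x, (x : H)⟫_ℂ).re ≤ z * ‖(x : H)‖ ^ 2 := by
    intro z hz
    obtain ⟨R, hR1, hR2⟩ := hres z hz
    have hsymm : IsSelfAdjoint R := by
      rw [ContinuousLinearMap.isSelfAdjoint_iff_isSymmetric]
      intro a b
      obtain ⟨ha, ea⟩ := hR1 a
      obtain ⟨hb, eb⟩ := hR1 b
      have h := hT ⟨R a, ha⟩ ⟨R b, hb⟩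
      simp only [ContinuousLinearMap.coe_coe]
      calc ⟪R a, b⟫_ℂ = ⟪R a, T ⟨R b, hb⟩ - (z : ℂ) • R b⟫_ℂ := by rw [eb]
        _ = ⟪T ⟨R a, ha⟩ - (z : ℂ) • R a, R b⟫_ℂ := by
          rw [inner_sub_left, inner_sub_right, inner_smul_left, inner_smul_right, h,
            Complex.conj_ofReal]
        _ = ⟪a, R b⟫_ℂ := by rw [ea]
    have hpos : 0 ≤ -R := by
      rw [StarOrderedRing.nonneg_iff_spectrum_nonneg (R := ℝ) (-R) hsymm.neg]
      intro w hw
      by_contra hneg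
      push Not at hneg
      refine hw ?_
      -- For `w < 0` the point `z - w⁻¹` exceeds `z`, so it has a resolvent `S`. The resolvent
      -- identity in both orders gives `R * S = S * R = w (R - S)`, which makes `w⁻¹ (1 - w⁻¹ S)` a
      -- two-sided inverse of `w + R`.
      obtain ⟨S, hS1, hS2⟩ := hres (z - w⁻¹) (by
        have : w⁻¹ < 0 := inv_lt_zero.2 hneg
        linarith)
      have e1 := resolvent_identity hR2 hS1
      have e2 := resolvent_identity hS2 hR1
      have hw0 : (w : ℂ) ≠ 0 := by exact_mod_cast hneg.ne
      have c1 : (((z - w⁻¹ : ℝ) : ℂ) - (z : ℂ)) = -(w : ℂ)⁻¹ := by push_cast; ring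
      have c2 : ((z : ℂ) - ((z - w⁻¹ : ℝ) : ℂ)) = (w : ℂ)⁻¹ := by push_cast; ring
      rw [c1] at e1
      rw [c2] at e2
      have halg : algebraMap ℝ (H →L[ℂ] H) w = (w : ℂ) • (1 : H →L[ℂ] H) := by
        ext y
        simp [Algebra.algebraMap_eq_smul_one]
      have hRS : R * S = (w : ℂ) • (R - S) := by
        rw [← neg_sub S R, e1, smul_neg, smul_smul, mul_neg, mul_inv_cancel₀ hw0]
        module
      have hSR : S * R = (w : ℂ) • (R - S) := by
        rw [e2, smul_smul, mul_inv_cancel₀ hw0, one_smul]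
      rw [spectrum.mem_resolventSet_iff, halg]
      refine ⟨⟨(w : ℂ) • 1 - -R, (w : ℂ)⁻¹ • (1 - (w : ℂ)⁻¹ • S), ?_, ?_⟩, rfl⟩
      · simp only [sub_neg_eq_add, add_mul, mul_smul_comm, mul_sub, smul_mul_assoc, one_mul,
          mul_one, hRS, smul_smul, smul_sub, smul_add]
        match_scalars <;> field_simp <;> ring
      · simp only [sub_neg_eq_add, sub_mul, mul_smul_comm, mul_add, smul_mul_assoc, one_mul,
          mul_one, hSR, smul_smul, smul_sub]
        match_scalars <;> field_simp <;> ring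
    have h := ((ContinuousLinearMap.nonneg_iff_isPositive _).1 hpos).re_inner_nonneg_right
      (T x - (z : ℂ) • (x : H))
    rw [neg_apply, hR2 x, inner_neg_right, inner_sub_left, inner_smul_left,
      Complex.conj_ofReal, inner_self_eq_norm_sq_to_K] at h
    simp only [RCLike.re_to_complex, Complex.neg_re, Complex.sub_re] at h
    have h3 : ((z : ℂ) * ((‖(x : H)‖ : ℂ)) ^ 2).re = z * ‖(x : H)‖ ^ 2 := by
      norm_cast
    have h4 := h3 ▸ h
    linarith
  by_contra hcon
  push Not at hcon
  have hc : Filter.Tendsto (fun z : ℝ => z * ‖(x : H)‖ ^ 2) (nhdsWithin M (Set.Ioi M))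
      (nhds (M * ‖(x : H)‖ ^ 2)) :=
    (Continuous.tendsto (by fun_prop) M).mono_left nhdsWithin_le_nhds
  refine absurd (ge_of_tendsto hc ?_) (not_le.2 hcon)
  filter_upwards [self_mem_nhdsWithin] with z hz using key z hz

/-- A vector on which a nonnegative quadratic form vanishes lies in the kernel of the form. -/
theorem inner_eq_zero_of_form_nonneg {H : Type*} [NormedAddCommGroup H]
    [InnerProductSpace ℂ H] {D : Submodule ℂ H} {A : D →ₗ[ℂ] H}
    (hA : ∀ x y : D, ⟪A x, (y : H)⟫_ℂ = ⟪(x : H), A y⟫_ℂ)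
    (hpos : ∀ x : D, 0 ≤ (⟪A x, (x : H)⟫_ℂ).re) {x : D}
    (hx : (⟪A x, (x : H)⟫_ℂ).re ≤ 0) (y : D) : (⟪A x, (y : H)⟫_ℂ).re = 0 := by
  have h : ∀ t : ℝ, 0 ≤ 2 * t * (⟪A x, (y : H)⟫_ℂ).re + t ^ 2 * (⟪A y, (y : H)⟫_ℂ).re := by
    intro t
    have h0 := hpos (x + (t : ℂ) • y)
    have h1 : (⟪A y, (x : H)⟫_ℂ).re = (⟪A x, (y : H)⟫_ℂ).re := by
      rw [hA y x, ← inner_conj_symm, Complex.conj_re]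
    simp only [map_add, map_smul, Submodule.coe_add, Submodule.coe_smul, inner_add_left,
      inner_add_right, inner_smul_left, inner_smul_right, Complex.conj_ofReal, Complex.add_re,
      Complex.re_ofReal_mul, h1] at h0
    nlinarith
  set a := (⟪A x, (y : H)⟫_ℂ).re
  set b := (⟪A y, (y : H)⟫_ℂ).re with hb
  have hb0 : 0 ≤ b := hpos y
  by_contra ha
  -- Close to the minimiser `-a / b` of the quadratic, but with `b + 1` because `b` may vanish.
  have h2 := h (-a / (b + 1))
  have h3 : 2 * (-a / (b + 1)) * a + (-a / (b + 1)) ^ 2 * b =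
      -(a ^ 2 * (b + 2)) / (b + 1) ^ 2 := by
    field_simp
    ring
  rw [h3] at h2
  have h4 : 0 < a ^ 2 * (b + 2) / (b + 1) ^ 2 := by positivity
  rw [neg_div] at h2
  linarith

/-! ### Symmetry of the Schrödinger operator -/

/-- The sum of the values of `f` over the `2d` nearest neighbours of `n`. -/
def neighborSum {d : ℕ} {R : Type*} [AddCommMonoid R] (f : (Fin d → ℤ) → R) (n : Fin d → ℤ) : R :=
  ∑ j : Fin d, (f (n + Pi.single j 1) + f (n - Pi.single j 1))

theorem negLaplacian_eq {d : ℕ} (ψ : (Fin d → ℤ) → ℂ) (n : Fin d → ℤ) :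
    negLaplacian ψ n = 2 * d * ψ n - neighborSum ψ n := by
  simp only [negLaplacian, neighborSum, Finset.sum_add_distrib, Finset.sum_sub_distrib,
    Finset.sum_const, Finset.card_univ, Fintype.card_fin, nsmul_eq_mul]
  ring

theorem schrodinger_apply {d : ℕ} (V : (Fin d → ℤ) → ℝ) (ψ : (schrodinger V).domain)
    (n : Fin d → ℤ) :
    (schrodinger V ψ : LatticeL2 d) n =
      (2 * d + V n) * (ψ : LatticeL2 d) n - neighborSum (ψ : LatticeL2 d) n := by
  have h : (schrodinger V ψ : LatticeL2 d) n =
      negLaplacian (ψ : LatticeL2 d) n + (V n : ℂ) * (ψ : LatticeL2 d) n := rfl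
  rw [h, negLaplacian_eq]
  ring

theorem mem_schrodinger_domain {d : ℕ} {V : (Fin d → ℤ) → ℝ} {ψ : LatticeL2 d} :
    ψ ∈ (schrodinger V).domain ↔
      Memℓp (E := fun _ : Fin d → ℤ => ℂ) (fun n => (V n : ℂ) * ψ n) 2 := Iff.rfl

theorem summable_inner_shift {d : ℕ} (φ ψ : LatticeL2 d) (k : Fin d → ℤ) :
    Summable fun n => ⟪φ (n + k), ψ n⟫_ℂ :=
  (lp.hasSum_inner (⟨fun n => φ (n + k),
    memℓp_comp_equiv (Equiv.addRight k) (lp.memℓp φ)⟩ : LatticeL2 d) ψ).summable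

/-- The adjoint of a shift is the inverse shift, so the two orientations of each direction are
exchanged. -/
theorem tsum_inner_neighborSum {d : ℕ} (φ ψ : LatticeL2 d) :
    (Summable fun n => ⟪neighborSum φ n, ψ n⟫_ℂ) ∧
    (Summable fun n => ⟪φ n, neighborSum ψ n⟫_ℂ) ∧
    ∑' n, ⟪neighborSum φ n, ψ n⟫_ℂ = ∑' n, ⟪φ n, neighborSum ψ n⟫_ℂ := by
  have hs := summable_inner_shift φ ψ
  have hs' : ∀ k, Summable fun n => ⟪φ n, ψ (n + k)⟫_ℂ := by
    intro k
    have h := (Equiv.addRight k).summable_iff.2 (hs (-k))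
    simpa [Function.comp_def] using h
  have he : ∀ k, ∑' n, ⟪φ n, ψ (n + k)⟫_ℂ = ∑' n, ⟪φ (n + -k), ψ n⟫_ℂ := by
    intro k
    rw [← (Equiv.addRight k).tsum_eq (fun n => ⟪φ (n + -k), ψ n⟫_ℂ)]
    simp
  have e1 : (fun n => ⟪neighborSum φ n, ψ n⟫_ℂ) = fun n => ∑ j : Fin d,
      (⟪φ (n + Pi.single j 1), ψ n⟫_ℂ + ⟪φ (n + -Pi.single j 1), ψ n⟫_ℂ) := by
    funext n
    simp only [neighborSum, sum_inner, inner_add_left, sub_eq_add_neg]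
  have e2 : (fun n => ⟪φ n, neighborSum ψ n⟫_ℂ) = fun n => ∑ j : Fin d,
      (⟪φ n, ψ (n + Pi.single j 1)⟫_ℂ + ⟪φ n, ψ (n + -Pi.single j 1)⟫_ℂ) := by
    funext n
    simp only [neighborSum, inner_sum, inner_add_right, sub_eq_add_neg]
  rw [e1, e2]
  refine ⟨summable_sum fun j _ => (hs _).add (hs _), summable_sum fun j _ => (hs' _).add (hs' _), ?_⟩
  rw [Summable.tsum_finsetSum fun j _ => (hs _).add (hs _),
    Summable.tsum_finsetSum fun j _ => (hs' _).add (hs' _)]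
  refine Finset.sum_congr rfl fun j _ => ?_
  rw [(hs _).tsum_add (hs _), (hs' _).tsum_add (hs' _), he, he, neg_neg, add_comm]

theorem schrodinger_symmetric {d : ℕ} (V : (Fin d → ℤ) → ℝ) (φ ψ : (schrodinger V).domain) :
    ⟪schrodinger V φ, (ψ : LatticeL2 d)⟫_ℂ = ⟪(φ : LatticeL2 d), schrodinger V ψ⟫_ℂ := by
  obtain ⟨s1, s2, e⟩ := tsum_inner_neighborSum (φ : LatticeL2 d) (ψ : LatticeL2 d)
  rw [lp.inner_eq_tsum, lp.inner_eq_tsum]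
  have h1 := (lp.hasSum_inner (𝕜 := ℂ) (schrodinger V φ : LatticeL2 d) (ψ : LatticeL2 d)).summable
  have h2 := (lp.hasSum_inner (𝕜 := ℂ) (φ : LatticeL2 d) (schrodinger V ψ : LatticeL2 d)).summable
  have t1 := h1.tsum_add s1
  have t2 := h2.tsum_add s2
  -- Adding the neighbour sums back leaves multiplication by the real function `2d + V`, which is
  -- symmetric pointwise.
  have h3 : ∀ n, ⟪(schrodinger V φ : LatticeL2 d) n, (ψ : LatticeL2 d) n⟫_ℂ +
      ⟪neighborSum (φ : LatticeL2 d) n, (ψ : LatticeL2 d) n⟫_ℂ =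
      ⟪(φ : LatticeL2 d) n, (schrodinger V ψ : LatticeL2 d) n⟫_ℂ +
      ⟪(φ : LatticeL2 d) n, neighborSum (ψ : LatticeL2 d) n⟫_ℂ := by
    intro n
    rw [schrodinger_apply, schrodinger_apply, ← inner_add_left, ← inner_add_right,
      sub_add_cancel, sub_add_cancel]
    have h : (2 * d + V n : ℂ) = ((2 * d + V n : ℝ) : ℂ) := by push_cast; ring
    rw [h, RCLike.inner_apply', RCLike.inner_apply', map_mul, Complex.conj_ofReal]
    ring
  simp only [h3] at t1
  rw [t1, e] at t2
  exact add_right_cancel t2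

/-! ### The modulus of a top eigenfunction -/

/-- The staggered sign `(-1)^(n₁ + ⋯ + n_d)`. -/
noncomputable def staggered {d : ℕ} (n : Fin d → ℤ) : ℂ := (-1 : ℂ) ^ (∑ j, n j)

theorem norm_staggered {d : ℕ} (n : Fin d → ℤ) : ‖staggered n‖ = 1 := by
  simp [staggered, norm_zpow]

theorem staggered_add_single {d : ℕ} (n : Fin d → ℤ) (j : Fin d) :
    staggered (n + Pi.single j 1) = -staggered n := by
  simp only [staggered, Pi.add_apply, Finset.sum_add_distrib, Finset.sum_pi_single',
    Finset.mem_univ, if_true]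
  rw [zpow_add₀ (by norm_num)]
  simp

theorem staggered_sub_single {d : ℕ} (n : Fin d → ℤ) (j : Fin d) :
    staggered (n - Pi.single j 1) = -staggered n := by
  rw [← neg_neg (staggered (n - Pi.single j 1)), ← staggered_add_single, sub_add_cancel]

theorem neighborSum_staggered_mul {d : ℕ} (f : (Fin d → ℤ) → ℝ) (n : Fin d → ℤ) :
    neighborSum (fun m => staggered m * (f m : ℂ)) n =
      -(staggered n * ((neighborSum f n : ℝ) : ℂ)) := by
  simp only [neighborSum, staggered_add_single, staggered_sub_single]
  push_cast
  rw [Finset.mul_sum, ← Finset.sum_neg_distrib]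
  exact Finset.sum_congr rfl fun j _ => by ring

theorem norm_neighborSum_le {d : ℕ} (ψ : (Fin d → ℤ) → ℂ) (n : Fin d → ℤ) :
    ‖neighborSum ψ n‖ ≤ neighborSum (fun m => ‖ψ m‖) n :=
  (norm_sum_le _ _).trans (Finset.sum_le_sum fun _ _ => norm_add_le _ _)

theorem memℓp_of_norm_eq {d : ℕ} {f g : (Fin d → ℤ) → ℂ}
    (hf : Memℓp (E := fun _ : Fin d → ℤ => ℂ) f 2) (h : ∀ n, ‖g n‖ = ‖f n‖) :
    Memℓp (E := fun _ : Fin d → ℤ => ℂ) g 2 := by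
  have h2 : 0 < (2 : ENNReal).toReal := by norm_num
  rw [memℓp_gen_iff h2] at hf ⊢
  simpa only [h] using hf

/-- If `4d` is an eigenvalue at the top of the spectrum, the modulus of an eigenfunction solves
the staggered eigenvalue equation. -/
theorem neighborSum_norm_eigenfunction {d : ℕ} {V : (Fin d → ℤ) → ℝ}
    (hM : (4 * d : ℝ) ∈ upperBounds {x : ℝ | (x : ℂ) ∈ (schrodinger V).spectrum})
    {ψ : (schrodinger V).domain}
    (hψ : schrodinger V ψ = ((4 * d : ℝ) : ℂ) • (ψ : LatticeL2 d)) (n : Fin d → ℤ) :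
    neighborSum (fun m => ‖(ψ : LatticeL2 d) m‖) n =
      (2 * d - V n) * ‖(ψ : LatticeL2 d) n‖ := by
  set v : (Fin d → ℤ) → ℝ := fun m => ‖(ψ : LatticeL2 d) m‖ with hv
  -- Triangle inequality in the eigenvalue equation; it makes the form of `4d - H_V` at `staggered *
  -- v` nonpositive.
  have hsub : ∀ n, (2 * d - V n) * v n ≤ neighborSum v n := by
    intro n
    have h := congrArg (fun f : LatticeL2 d => f n) hψ
    simp only [schrodinger_apply, lp.coeFn_smul, Pi.smul_apply, smul_eq_mul] at h
    have h1 : neighborSum (ψ : LatticeL2 d) n =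
        ((-(2 * d - V n) : ℝ) : ℂ) * (ψ : LatticeL2 d) n := by
      push_cast at h ⊢
      linear_combination -h
    have h2 := norm_neighborSum_le (ψ : LatticeL2 d) n
    rw [h1, norm_mul, Complex.norm_real, norm_neg] at h2
    exact (mul_le_mul_of_nonneg_right (Real.le_norm_self _) (norm_nonneg _)).trans h2
  have hmem : Memℓp (E := fun _ : Fin d → ℤ => ℂ) (fun m => staggered m * (v m : ℂ)) 2 :=
    memℓp_of_norm_eq (lp.memℓp (ψ : LatticeL2 d)) fun m => by
      simp [norm_staggered, hv]
  have hdom : (⟨_, hmem⟩ : LatticeL2 d) ∈ (schrodinger V).domain :=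
    mem_schrodinger_domain.2 <| memℓp_of_norm_eq (mem_schrodinger_domain.1 ψ.2) fun m => by
      simp [norm_staggered, hv]
  set x : (schrodinger V).domain := ⟨⟨_, hmem⟩, hdom⟩ with hxdef
  set A : (schrodinger V).domain →ₗ[ℂ] LatticeL2 d :=
    ((4 * d : ℝ) : ℂ) • (schrodinger V).domain.subtype - (schrodinger V).toFun with hA
  have hAapp : ∀ y, A y = ((4 * d : ℝ) : ℂ) • (y : LatticeL2 d) - schrodinger V y := fun y => rfl
  have hsymm : ∀ y z : (schrodinger V).domain,
      ⟪A y, (z : LatticeL2 d)⟫_ℂ = ⟪(y : LatticeL2 d), A z⟫_ℂ := by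
    intro y z
    rw [hAapp, hAapp, inner_sub_left, inner_sub_right, schrodinger_symmetric, inner_smul_left,
      inner_smul_right, Complex.conj_ofReal]
  have hpos : ∀ y : (schrodinger V).domain, 0 ≤ (⟪A y, (y : LatticeL2 d)⟫_ℂ).re := by
    intro y
    have h := re_inner_le_of_mem_upperBounds_spectrum (schrodinger_symmetric V) hM y
    have h1 : (⟪((4 * d : ℝ) : ℂ) • (y : LatticeL2 d), (y : LatticeL2 d)⟫_ℂ).re =
        4 * d * ‖(y : LatticeL2 d)‖ ^ 2 := by
      rw [inner_smul_left, Complex.conj_ofReal, Complex.re_ofReal_mul]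
      congr 1
      exact inner_self_eq_norm_sq (𝕜 := ℂ) (y : LatticeL2 d)
    rw [hAapp, inner_sub_left, Complex.sub_re, h1]
    exact sub_nonneg.2 h
  have hAx : ∀ m, (A x : LatticeL2 d) m =
      staggered m * (((2 * d - V m) * v m - neighborSum v m : ℝ) : ℂ) := by
    intro m
    have h : (A x : LatticeL2 d) m = ((4 * d : ℝ) : ℂ) * (staggered m * (v m : ℂ)) -
        ((2 * d + V m) * (staggered m * (v m : ℂ)) -
          neighborSum (fun k => staggered k * (v k : ℂ)) m) := by
      rw [hAapp, lp.coeFn_sub, Pi.sub_apply, schrodinger_apply]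
      rfl
    rw [h, neighborSum_staggered_mul]
    push_cast
    ring
  have hform : (⟪A x, (x : LatticeL2 d)⟫_ℂ).re ≤ 0 := by
    have h := (lp.hasSum_inner (𝕜 := ℂ) (A x) (x : LatticeL2 d)).mapL Complex.reCLM
    refine h.nonpos fun m => ?_
    have h1 : (x : LatticeL2 d) m = staggered m * (v m : ℂ) := rfl
    have h2 : (starRingEnd ℂ) (staggered m) * staggered m = 1 := by
      rw [← Complex.normSq_eq_conj_mul_self, Complex.normSq_eq_norm_sq, norm_staggered]
      simp
    have h3 : ⟪(A x : LatticeL2 d) m, (x : LatticeL2 d) m⟫_ℂ =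
        ((((2 * d - V m) * v m - neighborSum v m) * v m : ℝ) : ℂ) := by
      rw [hAx, h1, RCLike.inner_apply', map_mul, Complex.conj_ofReal, Complex.ofReal_mul]
      linear_combination (((2 * d - V m) * v m - neighborSum v m : ℝ) : ℂ) * (v m : ℂ) * h2
    rw [h3, Complex.reCLM_apply, Complex.ofReal_re]
    exact mul_nonpos_of_nonpos_of_nonneg (sub_nonpos.2 (hsub m)) (norm_nonneg _)
  -- Testing the kernel property against the point mass at `n` with value `(A x) n` yields `‖(A x)
  -- n‖² = 0`.
  have hsingle : lp.single 2 n ((A x : LatticeL2 d) n) ∈ (schrodinger V).domain := by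
    rw [mem_schrodinger_domain]
    have h : (fun m => (V m : ℂ) * (lp.single 2 n ((A x : LatticeL2 d) n) : LatticeL2 d) m) =
        (lp.single 2 n ((V n : ℂ) * (A x : LatticeL2 d) n) : LatticeL2 d) := by
      funext m
      rcases eq_or_ne m n with rfl | hm
      · simp only [lp.single_apply_self]
      · rw [lp.single_apply_ne _ _ _ hm, lp.single_apply_ne _ _ _ hm, mul_zero]
    exact (congrArg (fun f => Memℓp (E := fun _ : Fin d → ℤ => ℂ) f 2) h).mpr (lp.memℓp _)
  have hzero := inner_eq_zero_of_form_nonneg hsymm hpos hform ⟨_, hsingle⟩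
  rw [lp.inner_single_right] at hzero
  have hz : (A x : LatticeL2 d) n = 0 :=
    (inner_self_eq_zero (𝕜 := ℂ)).1 (Complex.ext hzero (by
      exact inner_self_im (𝕜 := ℂ) ((A x : LatticeL2 d) n)))
  rw [hAx, mul_eq_zero] at hz
  rcases hz with hz | hz
  · have := norm_staggered n
    rw [hz, norm_zero] at this
    exact absurd this zero_ne_one
  · have := Complex.ofReal_eq_zero.1 hz
    linarith

/-! ### Propagation along the edges of the lattice -/

/-- A nonnegative solution vanishing at one point vanishes everywhere. -/
theorem eq_zero_of_neighborSum_eq {d : ℕ} {W v : (Fin d → ℤ) → ℝ} (hv : ∀ n, 0 ≤ v n)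
    (h : ∀ n, neighborSum v n = W n * v n) {n₀ : Fin d → ℤ} (h₀ : v n₀ = 0) (n : Fin d → ℤ) :
    v n = 0 := by
  have hstep : ∀ n, v n = 0 → ∀ j : Fin d,
      v (n + Pi.single j 1) = 0 ∧ v (n - Pi.single j 1) = 0 := by
    intro n hn j
    have h1 := h n
    rw [hn, mul_zero, neighborSum,
      Finset.sum_eq_zero_iff_of_nonneg fun i _ => add_nonneg (hv _) (hv _)] at h1
    exact (add_eq_zero_iff_of_nonneg (hv _) (hv _)).1 (h1 j (Finset.mem_univ j))
  have hline : ∀ (j : Fin d) (k : ℤ) (n : Fin d → ℤ), v n = 0 → v (n + k • Pi.single j 1) = 0 := by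
    intro j k
    induction k with
    | zero => intro n hn; simpa using hn
    | succ i ih =>
      intro n hn
      rw [add_smul, one_smul, ← add_assoc]
      exact (hstep _ (ih n hn) j).1
    | pred i ih =>
      intro n hn
      rw [sub_smul, one_smul, ← add_sub_assoc]
      exact (hstep _ (ih n hn) j).2
  have hsum : ∀ s : Finset (Fin d), v (n₀ + ∑ j ∈ s, (n j - n₀ j) • Pi.single j (1 : ℤ)) = 0 := by
    intro s
    induction s using Finset.induction_on with
    | empty => simpa using h₀
    | insert a s ha ih =>
      rw [Finset.sum_insert ha, add_comm (_ • _), ← add_assoc]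
      exact hline _ _ _ ih
  have hn : n₀ + ∑ j, (n j - n₀ j) • Pi.single j (1 : ℤ) = n := by
    ext i
    simp [Finset.sum_apply, Pi.single_apply]
  rw [← hn]
  exact hsum _

/-- Functions invariant along all nearest neighbour edges are constant. -/
theorem eq_of_forall_add_single_eq {d : ℕ} {g : (Fin d → ℤ) → ℝ}
    (h : ∀ n j, g (n + Pi.single j 1) = g n) (n m : Fin d → ℤ) : g n = g m := by
  have h' : ∀ n j, g (n - Pi.single j 1) = g n := fun n j => by
    rw [← h (n - Pi.single j 1) j, sub_add_cancel]
  -- `|g - g m|` is also invariant along edges, hence a nonnegative solution with coefficient `2d`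
  -- that vanishes at `m`.
  have h0 := eq_zero_of_neighborSum_eq (W := fun _ => 2 * d) (v := fun k => |g k - g m|)
    (fun _ => abs_nonneg _) (fun k => by
      simp only [neighborSum, h, h', Finset.sum_const, Finset.card_univ, Fintype.card_fin,
        nsmul_eq_mul]
      ring) (n₀ := m) (by simp) n
  exact sub_eq_zero.1 (abs_eq_zero.1 h0)

/-! ### Caccioppoli inequality and comparison principle -/

theorem summable_of_mul_cutoff {ι : Type*} {χ f : ι → ℝ} (hχ : (Function.support χ).Finite)
    (hf : ∀ n, χ n = 0 → f n = 0) : Summable f :=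
  summable_of_hasFiniteSupport (hχ.subset fun n hn h => hn (hf n h))

theorem finite_support_comp_add {ι : Type*} [AddGroup ι] {χ : ι → ℝ}
    (hχ : (Function.support χ).Finite) (k : ι) : (Function.support fun n => χ (n + k)).Finite :=
  hχ.preimage (f := fun n => n + k) (add_left_injective k).injOn

/-- A Caccioppoli inequality on the lattice, with edge weights `v n * v m`. -/
theorem caccioppoli {d : ℕ} {v g χ : (Fin d → ℤ) → ℝ} (hv : ∀ n, 0 < v n)
    (hg : ∀ n, g n * (neighborSum v n * g n - neighborSum (fun m => v m * g m) n) ≤ 0)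
    (hχ : (Function.support χ).Finite) (n₀ : Fin d → ℤ) (j₀ : Fin d) :
    v n₀ * v (n₀ + Pi.single j₀ 1) *
        (χ n₀ * g n₀ - χ (n₀ + Pi.single j₀ 1) * g (n₀ + Pi.single j₀ 1)) ^ 2 ≤
      ∑' n, ∑ j, v n * g n * (v (n + Pi.single j 1) * g (n + Pi.single j 1)) *
        (χ n - χ (n + Pi.single j 1)) ^ 2 := by
  have hχ' : ∀ j : Fin d, (Function.support fun n : Fin d → ℤ => χ (n + Pi.single j 1)).Finite := fun j =>
    finite_support_comp_add hχ _
  set F : Fin d → (Fin d → ℤ) → ℝ := fun j n =>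
    χ n ^ 2 * (v n * g n * v (n + Pi.single j 1) * (g n - g (n + Pi.single j 1))) with hF
  set G : Fin d → (Fin d → ℤ) → ℝ := fun j n =>
    χ n ^ 2 * (v n * g n * v (n - Pi.single j 1) * (g n - g (n - Pi.single j 1))) with hG
  set D : Fin d → (Fin d → ℤ) → ℝ := fun j n => v n * v (n + Pi.single j 1) *
        (χ n * g n - χ (n + Pi.single j 1) * g (n + Pi.single j 1)) ^ 2 with hD
  set E : Fin d → (Fin d → ℤ) → ℝ := fun j n =>
    v n * g n * (v (n + Pi.single j 1) * g (n + Pi.single j 1)) *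
        (χ n - χ (n + Pi.single j 1)) ^ 2 with hE
  have hFs : ∀ j, Summable (F j) := fun j => summable_of_mul_cutoff hχ fun n h => by
    simp [hF, h]
  have hGs : ∀ j, Summable (G j) := fun j => summable_of_mul_cutoff hχ fun n h => by
    simp [hG, h]
  have hGs' : ∀ j, Summable fun n => G j (n + Pi.single j 1) := fun j =>
    summable_of_mul_cutoff (hχ' j) fun n h => by simp [hG, h]
  have hsupp : ∀ j, (Function.support χ ∪
      Function.support fun n : Fin d → ℤ => χ (n + Pi.single j 1)).Finite := fun j => hχ.union (hχ' j)
  have hDs : ∀ j, Summable (D j) := fun j => summable_of_hasFiniteSupport <|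
    (hsupp j).subset fun n hn => by
      by_contra h
      simp only [Set.mem_union, Function.mem_support, not_or, not_not] at h
      exact hn (by simp [hD, h.1, h.2])
  have hEs : ∀ j, Summable (E j) := fun j => summable_of_hasFiniteSupport <|
    (hsupp j).subset fun n hn => by
      by_contra h
      simp only [Set.mem_union, Function.mem_support, not_or, not_not] at h
      exact hn (by simp [hE, h.1, h.2])
  -- Each edge is seen once from either endpoint. The two contributions combine to the energy of `χ
  -- g` minus an error involving only differences of `χ`.
  have hpt : ∀ j n, F j n + G j (n + Pi.single j 1) = D j n - E j n := by
    intro j n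
    simp only [hF, hG, hD, hE, add_sub_cancel_right]
    ring
  -- This is `hg` summed against the nonnegative weight `χ² v`.
  have hle : ∑' n, ∑ j, (F j n + G j n) ≤ 0 := by
    refine tsum_nonpos fun n => ?_
    have h : ∑ j, (F j n + G j n) = χ n ^ 2 * v n *
        (g n * (neighborSum v n * g n - neighborSum (fun m => v m * g m) n)) := by
      simp only [hF, hG, neighborSum]
      rw [Finset.sum_mul, ← Finset.sum_sub_distrib, Finset.mul_sum, Finset.mul_sum]
      exact Finset.sum_congr rfl fun j _ => by ring
    rw [h]
    exact mul_nonpos_of_nonneg_of_nonpos (mul_nonneg (sq_nonneg _) (hv n).le) (hg n)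
  have heq : ∑' n, ∑ j, (F j n + G j n) = ∑' n, ∑ j, D j n - ∑' n, ∑ j, E j n := by
    rw [Summable.tsum_finsetSum fun j _ => (hFs j).add (hGs j),
      Summable.tsum_finsetSum fun j _ => hDs j, Summable.tsum_finsetSum fun j _ => hEs j,
      ← Finset.sum_sub_distrib]
    refine Finset.sum_congr rfl fun j _ => ?_
    have hshift : ∑' n : Fin d → ℤ, G j (n + Pi.single j 1) = ∑' n, G j n :=
      (Equiv.addRight (Pi.single j 1 : Fin d → ℤ)).tsum_eq (G j)
    rw [(hFs j).tsum_add (hGs j), ← hshift, ← (hFs j).tsum_add (hGs' j),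
      ← (hDs j).tsum_sub (hEs j)]
    exact tsum_congr fun n => hpt j n
  have hDnn : ∀ j n, 0 ≤ D j n := fun j n =>
    mul_nonneg (mul_nonneg (hv _).le (hv _).le) (sq_nonneg _)
  calc D j₀ n₀ ≤ ∑ j, D j n₀ :=
        Finset.single_le_sum (f := fun j => D j n₀) (fun j _ => hDnn j n₀) (Finset.mem_univ j₀)
    _ ≤ ∑' n, ∑ j, D j n :=
        (summable_sum fun j _ => hDs j).le_tsum n₀ fun n _ => Finset.sum_nonneg fun j _ => hDnn j n
    _ ≤ ∑' n, ∑ j, E j n := by linarith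

/-- A positive solution dominates every subsolution at infinity whose square weights admit
cutoffs of vanishing energy. -/
theorem mul_le_of_subsolution {d : ℕ} {W φ v : (Fin d → ℤ) → ℝ} (hv : ∀ n, 0 < v n)
    (hvW : ∀ n, neighborSum v n = W n * v n) (hφ : ∀ n, 0 ≤ φ n) {c : ℝ} (hc : 0 ≤ c)
    {A : Set (Fin d → ℤ)} {a : Fin d → ℤ} (ha : a ∈ A) (hA : ∀ n ∈ A, c * φ n ≤ v n)
    (hsub : ∀ n ∉ A, W n * φ n ≤ neighborSum φ n) {χ : ℕ → (Fin d → ℤ) → ℝ}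
    (hχ : ∀ k, (Function.support (χ k)).Finite) (hχ1 : ∀ n, Tendsto (χ · n) atTop (𝓝 1))
    (hE : Tendsto (fun k => ∑' n, ∑ j, φ n * φ (n + Pi.single j 1) *
      (χ k n - χ k (n + Pi.single j 1)) ^ 2) atTop (𝓝 0)) (n : Fin d → ℤ) :
    c * φ n ≤ v n := by
  set p : (Fin d → ℤ) → ℝ := fun n => max (c * φ n - v n) 0 with hp
  set g : (Fin d → ℤ) → ℝ := fun n => p n / v n with hgdef
  have hvg : ∀ n, v n * g n = p n := fun n => mul_div_cancel₀ _ (hv n).ne'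
  have hp0 : ∀ n, 0 ≤ p n := fun n => le_max_right _ _
  have hg0 : ∀ n, 0 ≤ g n := fun n => div_nonneg (hp0 n) (hv n).le
  have hpφ : ∀ n, p n ≤ c * φ n := fun n =>
    max_le (by linarith [hv n]) (mul_nonneg hc (hφ n))
  have hpA : ∀ n ∈ A, p n = 0 := fun n hn => max_eq_right (by linarith [hA n hn])
  -- The positive part of a subsolution is a subsolution, and division by the solution `v` removes
  -- the potential.
  have hg : ∀ n, g n * (neighborSum v n * g n - neighborSum (fun m => v m * g m) n) ≤ 0 := by
    intro n
    simp only [hvg]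
    rw [hvW, mul_assoc, hvg]
    rcases (hp0 n).eq_or_lt with h | h
    · have : g n = 0 := by simp only [hgdef, ← h, zero_div]
      rw [this, zero_mul]
    · have hnA : n ∉ A := fun hn => h.ne' (hpA n hn)
      have hpn : p n = c * φ n - v n := by
        rcases le_total (c * φ n - v n) 0 with h' | h'
        · exact absurd (max_eq_right h') h.ne'
        · exact max_eq_left h'
      refine mul_nonpos_of_nonneg_of_nonpos (hg0 n) (sub_nonpos.2 ?_)
      have h1 : neighborSum (fun m => c * φ m - v m) n ≤ neighborSum p n :=
        Finset.sum_le_sum fun j _ => add_le_add (le_max_left _ _) (le_max_left _ _)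
      have h2 : neighborSum (fun m => c * φ m - v m) n = c * neighborSum φ n - neighborSum v n := by
        simp only [neighborSum]
        rw [Finset.mul_sum, ← Finset.sum_sub_distrib]
        exact Finset.sum_congr rfl fun j _ => by ring
      have h3 := mul_le_mul_of_nonneg_left (hsub n hnA) hc
      rw [h2, hvW] at h1
      rw [hpn]
      nlinarith
  have hχ' : ∀ k (j : Fin d), (Function.support fun n : Fin d → ℤ => χ k (n + Pi.single j 1)).Finite :=
    fun k j => finite_support_comp_add (hχ k) _
  have hsum : ∀ (f : (Fin d → ℤ) → ℝ) k, Summable fun n => ∑ j, f n * f (n + Pi.single j 1) *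
      (χ k n - χ k (n + Pi.single j 1)) ^ 2 := fun f k => summable_sum fun j _ =>
    summable_of_hasFiniteSupport <| ((hχ k).union (hχ' k j)).subset fun n hn => by
      by_contra h
      simp only [Set.mem_union, Function.mem_support, not_or, not_not] at h
      exact hn (by simp [h.1, h.2])
  have hconst : ∀ n j, g (n + Pi.single j 1) = g n := by
    intro n j
    -- The error weights are `p n * p m` with `p = v g`, and `p ≤ c φ`; so the vanishing cutoff
    -- energy of `φ` controls the energy of `g`.
    have hbound : ∀ k, v n * v (n + Pi.single j 1) *
        (χ k n * g n - χ k (n + Pi.single j 1) * g (n + Pi.single j 1)) ^ 2 ≤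
        c ^ 2 * ∑' n, ∑ j, φ n * φ (n + Pi.single j 1) *
          (χ k n - χ k (n + Pi.single j 1)) ^ 2 := by
      intro k
      refine (caccioppoli hv hg (hχ k) n j).trans ?_
      simp only [hvg]
      rw [← tsum_mul_left]
      refine (hsum p k).tsum_le_tsum (fun m => ?_) ((hsum φ k).mul_left _)
      rw [Finset.mul_sum]
      refine Finset.sum_le_sum fun i _ => ?_
      rw [← mul_assoc]
      refine mul_le_mul_of_nonneg_right ?_ (sq_nonneg _)
      calc p m * p (m + Pi.single i 1) ≤ c * φ m * (c * φ (m + Pi.single i 1)) :=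
            mul_le_mul (hpφ _) (hpφ _) (hp0 _) (mul_nonneg hc (hφ _))
        _ = _ := by ring
    have hlim : Tendsto (fun k => v n * v (n + Pi.single j 1) *
        (χ k n * g n - χ k (n + Pi.single j 1) * g (n + Pi.single j 1)) ^ 2) atTop
        (𝓝 (v n * v (n + Pi.single j 1) * (1 * g n - 1 * g (n + Pi.single j 1)) ^ 2)) :=
      (((((hχ1 _).mul_const _).sub ((hχ1 _).mul_const _)).pow 2).const_mul _)
    have h := le_of_tendsto_of_tendsto' hlim (hE.const_mul (c ^ 2)) hbound
    rw [mul_zero, one_mul, one_mul] at h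
    have hvv := mul_pos (hv n) (hv (n + Pi.single j 1))
    have hsq : (g n - g (n + Pi.single j 1)) ^ 2 = 0 :=
      le_antisymm (nonpos_of_mul_nonpos_right h hvv) (sq_nonneg _)
    linarith [pow_eq_zero_iff (two_ne_zero) |>.1 hsq]
  have hgn : g n = 0 := by
    rw [eq_of_forall_add_single_eq hconst n a]
    simp only [hgdef, hpA a ha, zero_div]
  have hpn : p n = 0 := by rw [← hvg, hgn, mul_zero]
  have := le_max_left (c * φ n - v n) 0
  change c * φ n - v n ≤ p n at this
  linarith

/-! ### Dyadic boxes and cutoffs of vanishing energy -/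

/-- The lattice points of supremum norm at most `2 ^ k`. -/
noncomputable def dyadicBox (d k : ℕ) : Finset (Fin d → ℤ) :=
  Finset.Icc (fun _ => -(2 : ℤ) ^ k) (fun _ => (2 : ℤ) ^ k)

theorem mem_dyadicBox {d k : ℕ} {n : Fin d → ℤ} : n ∈ dyadicBox d k ↔ ‖n‖ ≤ 2 ^ k := by
  rw [dyadicBox, Finset.mem_Icc, pi_norm_le_iff_of_nonneg (by positivity)]
  simp only [Pi.le_def, ← forall_and, ← abs_le, Int.norm_eq_abs]
  exact forall_congr' fun j => by exact_mod_cast Iff.rfl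

theorem card_dyadicBox (d k : ℕ) : (dyadicBox d k).card = (2 * 2 ^ k + 1) ^ d := by
  rw [dyadicBox, Pi.card_Icc]
  simp only [Int.card_Icc, Finset.prod_const, Finset.card_univ, Fintype.card_fin]
  congr 1
  have : (2 : ℤ) ^ k + 1 - -2 ^ k = ((2 * 2 ^ k + 1 : ℕ) : ℤ) := by push_cast; ring
  rw [this, Int.toNat_natCast]

theorem norm_single_one_le {d : ℕ} (j : Fin d) : ‖(Pi.single j 1 : Fin d → ℤ)‖ ≤ 1 := by
  rw [pi_norm_le_iff_of_nonneg zero_le_one]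
  intro i
  rcases eq_or_ne i j with rfl | h
  · simp
  · simp [Pi.single_eq_of_ne h]

/-- Each dyadic shell contributes a bounded amount: it has at most `(5 * 2^k)^d` points, where `φ² ≤
2^(-k d)`. The mass thus grows only linearly in `k`. -/
theorem sum_sq_dyadicBox_le {d : ℕ} {φ : (Fin d → ℤ) → ℝ}
    (hφ1 : ∀ n, φ n ^ 2 ≤ 1) (hφd : ∀ n, φ n ^ 2 * ‖n‖ ^ d ≤ 1) (k : ℕ) :
    ∑ n ∈ dyadicBox d k, φ n ^ 2 ≤ (k + 1) * 8 ^ d := by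
  induction k with
  | zero =>
    calc ∑ n ∈ dyadicBox d 0, φ n ^ 2 ≤ ∑ n ∈ dyadicBox d 0, (1 : ℝ) :=
          Finset.sum_le_sum fun n _ => hφ1 n
      _ = 3 ^ d := by
        rw [Finset.sum_const, card_dyadicBox]
        norm_num
      _ ≤ (((0 : ℕ) : ℝ) + 1) * 8 ^ d := by
        rw [Nat.cast_zero, zero_add, one_mul]
        exact pow_le_pow_left₀ (by norm_num) (by norm_num) d
  | succ k ih =>
    have hsub : dyadicBox d k ⊆ dyadicBox d (k + 1) := fun n hn => by
      rw [mem_dyadicBox] at hn ⊢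
      exact hn.trans (pow_le_pow_right₀ one_le_two k.le_succ)
    rw [← Finset.sum_sdiff hsub]
    have h2k : (1 : ℝ) ≤ 2 ^ k := one_le_pow₀ one_le_two
    have hpos : (0 : ℝ) < (2 ^ k) ^ d := by positivity
    have h1 : ∑ n ∈ dyadicBox d (k + 1) \ dyadicBox d k, φ n ^ 2 ≤
        ∑ n ∈ dyadicBox d (k + 1) \ dyadicBox d k, ((2 : ℝ) ^ k) ^ d / ((2 ^ k) ^ d * (2 ^ k) ^ d) := by
      refine Finset.sum_le_sum fun n hn => ?_
      rw [Finset.mem_sdiff, mem_dyadicBox, mem_dyadicBox, not_le] at hn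
      rw [div_mul_cancel_left₀ hpos.ne', ← one_div, le_div_iff₀ hpos]
      exact (mul_le_mul_of_nonneg_left (pow_le_pow_left₀ (by positivity) hn.2.le d)
        (sq_nonneg _)).trans (hφd n)
    have h2 : ∑ n ∈ dyadicBox d (k + 1) \ dyadicBox d k,
        ((2 : ℝ) ^ k) ^ d / ((2 ^ k) ^ d * (2 ^ k) ^ d) ≤ 8 ^ d := by
      rw [Finset.sum_const, nsmul_eq_mul, div_mul_cancel_left₀ hpos.ne', ← div_eq_mul_inv,
        div_le_iff₀ hpos, ← mul_pow]
      have h3 : ((dyadicBox d (k + 1) \ dyadicBox d k).card : ℝ) ≤ (2 * 2 ^ (k + 1) + 1) ^ d := by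
        have := Finset.card_le_card (Finset.sdiff_subset (s := dyadicBox d (k + 1))
          (t := dyadicBox d k))
        rw [card_dyadicBox] at this
        exact_mod_cast this
      refine h3.trans (pow_le_pow_left₀ (by positivity) ?_ d)
      rw [pow_succ]
      linarith
    push_cast
    linarith

/-- The Lipschitz cutoff function at scale `2 ^ k`. -/
noncomputable def cutoff {d : ℕ} (k : ℕ) (n : Fin d → ℤ) : ℝ := max (1 - ‖n‖ / 2 ^ k) 0

theorem cutoff_eq_zero {d k : ℕ} {n : Fin d → ℤ} (h : 2 ^ k ≤ ‖n‖) : cutoff k n = 0 :=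
  max_eq_right (by
    have : 1 ≤ ‖n‖ / 2 ^ k := (one_le_div (by positivity)).2 h
    linarith)

theorem finite_support_cutoff {d : ℕ} (k : ℕ) :
    (Function.support (cutoff k : (Fin d → ℤ) → ℝ)).Finite :=
  (dyadicBox d k).finite_toSet.subset fun n hn => by
    rw [Finset.mem_coe, mem_dyadicBox]
    by_contra h
    exact hn (cutoff_eq_zero (not_le.1 h).le)

theorem tendsto_cutoff {d : ℕ} (n : Fin d → ℤ) :
    Tendsto (fun k => cutoff k n) atTop (𝓝 1) := by
  have h : Tendsto (fun k : ℕ => ‖n‖ / (2 : ℝ) ^ k) atTop (𝓝 0) :=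
    tendsto_const_nhds.div_atTop (tendsto_pow_atTop_atTop_of_one_lt one_lt_two)
  have h2 := ((tendsto_const_nhds (x := (1 : ℝ))).sub h).max (tendsto_const_nhds (x := (0 : ℝ)))
  simpa [cutoff] using h2

theorem sq_cutoff_sub_le {d : ℕ} (k : ℕ) (n : Fin d → ℤ) (j : Fin d) :
    (cutoff k n - cutoff k (n + Pi.single j 1)) ^ 2 ≤ 1 / 4 ^ k := by
  have h1 : |cutoff k n - cutoff k (n + Pi.single j 1)| ≤ 1 / 2 ^ k := by
    refine (abs_max_sub_max_le_abs _ _ 0).trans ?_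
    have h : (1 - ‖n‖ / 2 ^ k) - (1 - ‖n + Pi.single j 1‖ / 2 ^ k) =
      (‖n + Pi.single j 1‖ - ‖n‖) / 2 ^ k := by ring
    rw [h, abs_div, abs_of_pos (a := (2 : ℝ) ^ k) (by positivity)]
    refine div_le_div_of_nonneg_right ((abs_norm_sub_norm_le _ _).trans ?_) (by positivity)
    rw [add_sub_cancel_left]
    exact norm_single_one_le j
  calc _ = |cutoff k n - cutoff k (n + Pi.single j 1)| ^ 2 := (sq_abs _).symm
    _ ≤ (1 / 2 ^ k) ^ 2 := pow_le_pow_left₀ (abs_nonneg _) h1 2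
    _ = 1 / 4 ^ k := by
      rw [div_pow, one_pow, ← pow_mul, mul_comm, pow_mul]
      norm_num

/-- The mass in the box is `O(k)`, while the squared increments of the cutoff are at most `4^(-k)`.
-/
theorem tendsto_cutoff_energy {d : ℕ} {φ : (Fin d → ℤ) → ℝ} (hφ0 : ∀ n, 0 ≤ φ n)
    (hφ1 : ∀ n, φ n ^ 2 ≤ 1) (hφd : ∀ n, φ n ^ 2 * ‖n‖ ^ d ≤ 1) :
    Tendsto (fun k => ∑' n, ∑ j, φ n * φ (n + Pi.single j 1) *
      (cutoff k n - cutoff k (n + Pi.single j 1)) ^ 2) atTop (𝓝 0) := by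
  have hlim : Tendsto (fun k : ℕ => (d : ℝ) * 8 ^ d * ((k : ℝ) ^ 1 * (1 / 4 : ℝ) ^ k +
      3 * (1 / 4 : ℝ) ^ k)) atTop (𝓝 ((d : ℝ) * 8 ^ d * (0 + 3 * 0))) :=
    ((tendsto_pow_const_mul_const_pow_of_abs_lt_one 1 (by norm_num [abs_of_pos])).add
      ((tendsto_pow_atTop_nhds_zero_of_lt_one (by norm_num) (by norm_num)).const_mul 3)).const_mul _
  rw [mul_zero, add_zero, mul_zero] at hlim
  refine squeeze_zero (fun k => tsum_nonneg fun n => Finset.sum_nonneg fun j _ =>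
    mul_nonneg (mul_nonneg (hφ0 _) (hφ0 _)) (sq_nonneg _)) (fun k => ?_) hlim
  have h2k : (1 : ℝ) ≤ 2 ^ k := one_le_pow₀ one_le_two
  have hsub : dyadicBox d (k + 1) ⊆ dyadicBox d (k + 2) := fun n hn => by
    rw [mem_dyadicBox] at hn ⊢
    exact hn.trans (pow_le_pow_right₀ one_le_two (k + 1).le_succ)
  -- An edge meeting the support starts within `2^k + 1 ≤ 2^(k+1)` of the origin, and its other end
  -- stays in the box of index `k + 2`.
  rw [tsum_eq_sum (s := dyadicBox d (k + 1)), Finset.sum_comm]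
  · have hj : ∀ j : Fin d, ∑ n ∈ dyadicBox d (k + 1), φ n * φ (n + Pi.single j 1) *
        (cutoff k n - cutoff k (n + Pi.single j 1)) ^ 2 ≤ (k + 3) * 8 ^ d * (1 / 4) ^ k := by
      intro j
      have hS := sum_sq_dyadicBox_le hφ1 hφd (k + 2)
      have hA : ∑ n ∈ dyadicBox d (k + 1), φ n ^ 2 ≤ (k + 3) * 8 ^ d := by
        refine (Finset.sum_le_sum_of_subset_of_nonneg hsub fun _ _ _ => sq_nonneg _).trans
          (hS.trans_eq ?_)
        push_cast
        ring
      have hB : ∑ n ∈ dyadicBox d (k + 1), φ (n + Pi.single j 1) ^ 2 ≤ (k + 3) * 8 ^ d := by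
        rw [← Finset.sum_image (f := fun n => φ n ^ 2)
          (g := fun n : Fin d → ℤ => n + Pi.single j 1) fun a _ b _ h => add_right_cancel h]
        refine (Finset.sum_le_sum_of_subset_of_nonneg (Finset.image_subset_iff.2 fun n hn => ?_)
          fun _ _ _ => sq_nonneg _).trans (hS.trans_eq ?_)
        · rw [mem_dyadicBox] at hn ⊢
          have := (norm_add_le n (Pi.single j 1)).trans (add_le_add hn (norm_single_one_le j))
          rw [pow_succ] at this ⊢
          rw [pow_succ]
          linarith
        · push_cast
          ring
      calc _ ≤ ∑ n ∈ dyadicBox d (k + 1),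
            (φ n ^ 2 + φ (n + Pi.single j 1) ^ 2) / 2 * (1 / 4 ^ k) :=
          Finset.sum_le_sum fun n _ => mul_le_mul
            (by nlinarith [sq_nonneg (φ n - φ (n + Pi.single j 1))])
            (sq_cutoff_sub_le k n j) (sq_nonneg _) (by positivity)
        _ = (∑ n ∈ dyadicBox d (k + 1), φ n ^ 2 +
            ∑ n ∈ dyadicBox d (k + 1), φ (n + Pi.single j 1) ^ 2) / 2 * (1 / 4 ^ k) := by
          rw [← Finset.sum_mul, ← Finset.sum_div, Finset.sum_add_distrib]
        _ ≤ (k + 3) * 8 ^ d * (1 / 4 ^ k) :=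
          mul_le_mul_of_nonneg_right (by linarith) (by positivity)
        _ = _ := by rw [div_pow, one_pow]
    refine (Finset.sum_le_sum fun j _ => hj j).trans_eq ?_
    rw [Finset.sum_const, Finset.card_univ, Fintype.card_fin, nsmul_eq_mul]
    ring
  · intro n hn
    rw [mem_dyadicBox, not_le, pow_succ] at hn
    refine Finset.sum_eq_zero fun j _ => ?_
    have h1 : ‖n‖ ≤ ‖n + Pi.single j 1‖ + 1 := by
      have := norm_sub_le (n + Pi.single j 1) (Pi.single j 1)
      rw [add_sub_cancel_right] at this
      linarith [norm_single_one_le j]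
    rw [cutoff_eq_zero (by linarith), cutoff_eq_zero (by linarith)]
    simp

/-! ### Iterated logarithms and the radial weight -/

theorem tendsto_iterLog (i : ℕ) : Tendsto (iterLog i) atTop atTop := by
  induction i with
  | zero => exact tendsto_id
  | succ i ih => exact Real.tendsto_log_atTop.comp ih

theorem exists_forall_one_le_iterLog (s : ℕ) :
    ∃ r₀ : ℝ, 1 ≤ r₀ ∧ ∀ r, r₀ ≤ r → ∀ i ≤ s, 1 ≤ iterLog i r := by
  have h : ∀ᶠ r in atTop, ∀ i ∈ Finset.range (s + 1), 1 ≤ iterLog i r :=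
    (Finset.eventually_all _).2 fun i _ => (tendsto_iterLog i).eventually_ge_atTop 1
  obtain ⟨r₀, hr₀⟩ := eventually_atTop.1 h
  refine ⟨max r₀ 1, le_max_right _ _, fun r hr i hi => ?_⟩
  exact hr₀ r ((le_max_left _ _).trans hr) i (Finset.mem_range.2 (Nat.lt_succ_of_le hi))

/-- Positivity of the lower iterates is needed because `Real.log` is not monotone across zero. -/
theorem iterLog_le_iterLog {x y : ℝ} (hxy : x ≤ y) {i : ℕ} (hx : ∀ k < i, 0 < iterLog k x) :
    iterLog i x ≤ iterLog i y := by
  induction i with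
  | zero => exact hxy
  | succ i ih => exact Real.log_le_log (hx i i.lt_succ_self) (ih fun k hk => hx k (hk.trans i.lt_succ_self))

theorem log_sub_log_le {a b : ℝ} (ha : 0 < a) (hb : 0 < b) :
    Real.log b - Real.log a ≤ (b - a) / a := by
  rw [← Real.log_div hb.ne' ha.ne', sub_div, div_self ha.ne']
  exact Real.log_le_sub_one_of_pos (div_pos hb ha)

/-- Concavity of the iterated logarithms, in terms of the increment of the logarithm. -/
theorem iterLog_succ_sub_le {x y : ℝ} {i : ℕ} (hx : ∀ k ≤ i, 0 < iterLog k x)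
    (hy : ∀ k ≤ i, 0 < iterLog k y) :
    iterLog (i + 1) y - iterLog (i + 1) x ≤
      (Real.log y - Real.log x) * ∏ k ∈ Finset.Icc 1 i, 1 / iterLog k x := by
  induction i with
  | zero => simp [iterLog]
  | succ i ih =>
    rw [Finset.prod_Icc_succ_top (Nat.le_add_left 1 i), ← mul_assoc]
    calc iterLog (i + 1 + 1) y - iterLog (i + 1 + 1) x
        ≤ (iterLog (i + 1) y - iterLog (i + 1) x) / iterLog (i + 1) x :=
          log_sub_log_le (hx _ le_rfl) (hy _ le_rfl)
      _ ≤ _ := by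
        rw [div_eq_mul_one_div]
        exact mul_le_mul_of_nonneg_right
          (ih (fun k hk => hx k (hk.trans i.le_succ)) fun k hk => hy k (hk.trans i.le_succ))
          (one_div_nonneg.2 (hx _ le_rfl).le)

/-- The inverse square of the comparison function. -/
noncomputable def radialWeight (d s : ℕ) (r : ℝ) : ℝ := r ^ d * ∏ i ∈ Finset.Icc 1 s, iterLog i r

theorem one_le_prod_iterLog {s : ℕ} {r : ℝ} (h : ∀ i ≤ s, 1 ≤ iterLog i r) :
    1 ≤ ∏ i ∈ Finset.Icc 1 s, iterLog i r := by
  simpa using Finset.prod_le_prod (s := Finset.Icc 1 s) (f := fun _ => (1 : ℝ))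
    (fun _ _ => zero_le_one) fun i hi => h i (Finset.mem_Icc.1 hi).2

theorem pow_le_radialWeight {d s : ℕ} {r : ℝ} (h : ∀ i ≤ s, 1 ≤ iterLog i r) :
    r ^ d ≤ radialWeight d s r :=
  le_mul_of_one_le_right (pow_nonneg (zero_le_one.trans (h 0 s.zero_le)) d)
    (one_le_prod_iterLog h)

theorem one_le_radialWeight {d s : ℕ} {r : ℝ} (h : ∀ i ≤ s, 1 ≤ iterLog i r) :
    1 ≤ radialWeight d s r :=
  (one_le_pow₀ (h 0 s.zero_le)).trans (pow_le_radialWeight h)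

theorem radialWeight_le_radialWeight {d s : ℕ} {x y : ℝ} (h : ∀ i ≤ s, 1 ≤ iterLog i x)
    (hxy : x ≤ y) : radialWeight d s x ≤ radialWeight d s y := by
  have h0 : 0 ≤ x := zero_le_one.trans (h 0 s.zero_le)
  refine mul_le_mul (pow_le_pow_left₀ h0 hxy d) (Finset.prod_le_prod (fun i hi => ?_) fun i hi => ?_)
    (zero_le_one.trans (one_le_prod_iterLog h)) (pow_nonneg (h0.trans hxy) d)
  · exact zero_le_one.trans (h i (Finset.mem_Icc.1 hi).2)
  · exact iterLog_le_iterLog hxy fun k hk =>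
      zero_lt_one.trans_le (h k (hk.le.trans (Finset.mem_Icc.1 hi).2))

theorem sqrt_finset_prod {ι : Type*} (t : Finset ι) {f : ι → ℝ} (hf : ∀ i ∈ t, 0 ≤ f i) :
    Real.sqrt (∏ i ∈ t, f i) = ∏ i ∈ t, Real.sqrt (f i) := by
  classical
  induction t using Finset.induction_on with
  | empty => simp
  | insert a t ha ih =>
    rw [Finset.prod_insert ha, Finset.prod_insert ha,
      Real.sqrt_mul (hf a (Finset.mem_insert_self a t)),
      ih fun i hi => hf i (Finset.mem_insert_of_mem hi)]

theorem comparisonRatio_eq_sqrt {d s : ℕ} {n m : Fin d → ℤ}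
    (hn : ∀ i ≤ s, 1 ≤ iterLog i (latticeNorm n)) (hm : ∀ i ≤ s, 1 ≤ iterLog i (latticeNorm m)) :
    comparisonRatio s n m =
      Real.sqrt (radialWeight d s (latticeNorm n) / radialWeight d s (latticeNorm m)) := by
  have h0 : 0 ≤ latticeNorm n / latticeNorm m := div_nonneg (Real.sqrt_nonneg _) (Real.sqrt_nonneg _)
  rw [radialWeight, radialWeight, mul_div_mul_comm, ← div_pow, ← Finset.prod_div_distrib,
    Real.sqrt_mul (pow_nonneg h0 d), sqrt_finset_prod, comparisonRatio, Real.sqrt_eq_rpow,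
    ← Real.rpow_natCast, ← Real.rpow_mul h0, mul_one_div]
  intro i hi
  have hi := (Finset.mem_Icc.1 hi).2
  exact div_nonneg (zero_le_one.trans (hn i hi)) (zero_le_one.trans (hm i hi))

/-! ### The Euclidean norm on the lattice -/

theorem latticeNorm_eq_norm {d : ℕ} (n : Fin d → ℤ) :
    latticeNorm n = ‖WithLp.toLp 2 (fun j => (n j : ℝ))‖ := by
  rw [EuclideanSpace.norm_eq, latticeNorm]
  simp

theorem latticeNorm_sq {d : ℕ} (n : Fin d → ℤ) : latticeNorm n ^ 2 = ∑ j, (n j : ℝ) ^ 2 :=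
  Real.sq_sqrt (Finset.sum_nonneg fun _ _ => sq_nonneg _)

theorem latticeNorm_add_le {d : ℕ} (n m : Fin d → ℤ) :
    latticeNorm (n + m) ≤ latticeNorm n + latticeNorm m := by
  simp only [latticeNorm_eq_norm]
  refine le_trans (le_of_eq ?_) (norm_add_le _ _)
  congr 1
  ext j
  simp

theorem latticeNorm_neg {d : ℕ} (n : Fin d → ℤ) : latticeNorm (-n) = latticeNorm n := by
  simp [latticeNorm]

theorem latticeNorm_single {d : ℕ} (j : Fin d) : latticeNorm (Pi.single j 1 : Fin d → ℤ) = 1 := by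
  have h : ∀ i : Fin d, (((Pi.single j 1 : Fin d → ℤ) i : ℤ) : ℝ) ^ 2 = if i = j then 1 else 0 := by
    intro i
    by_cases h : i = j <;> simp [h]
  rw [latticeNorm]
  simp only [h]
  simp

theorem latticeNorm_sub_one_le_add_single {d : ℕ} (n : Fin d → ℤ) (j : Fin d) :
    latticeNorm n - 1 ≤ latticeNorm (n + Pi.single j 1) := by
  have h := latticeNorm_add_le (n + Pi.single j 1) (-Pi.single j 1)
  rw [add_neg_cancel_right, latticeNorm_neg, latticeNorm_single] at h
  linarith

theorem latticeNorm_sub_one_le_sub_single {d : ℕ} (n : Fin d → ℤ) (j : Fin d) :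
    latticeNorm n - 1 ≤ latticeNorm (n - Pi.single j 1) := by
  have h := latticeNorm_add_le (n - Pi.single j 1) (Pi.single j 1)
  rw [sub_add_cancel, latticeNorm_single] at h
  linarith

theorem abs_le_latticeNorm {d : ℕ} (n : Fin d → ℤ) (j : Fin d) : |(n j : ℝ)| ≤ latticeNorm n :=
  Real.abs_le_sqrt (Finset.single_le_sum (f := fun j => (n j : ℝ) ^ 2)
    (fun _ _ => sq_nonneg _) (Finset.mem_univ j))

theorem norm_le_latticeNorm {d : ℕ} (n : Fin d → ℤ) : ‖n‖ ≤ latticeNorm n := by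
  refine (pi_norm_le_iff_of_nonneg (Real.sqrt_nonneg _)).2 ?_
  intro j
  rw [Int.norm_eq_abs]
  exact abs_le_latticeNorm n j

theorem latticeNorm_le_mul {d : ℕ} {n : Fin d → ℤ} {k : ℝ} (hk : 0 ≤ k)
    (h : ∀ j, |(n j : ℝ)| ≤ k) : latticeNorm n ≤ d * k := by
  refine Real.sqrt_le_iff.2 ⟨by positivity, ?_⟩
  calc ∑ j, (n j : ℝ) ^ 2 ≤ ∑ _j : Fin d, k ^ 2 :=
        Finset.sum_le_sum fun j _ => sq_le_sq' (neg_le_of_abs_le (h j)) (le_of_abs_le (h j))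
    _ = d * k ^ 2 := by simp
    _ ≤ (d * k) ^ 2 := by
      rw [mul_pow]
      refine mul_le_mul_of_nonneg_right ?_ (sq_nonneg k)
      exact_mod_cast Nat.le_self_pow two_ne_zero d

theorem finite_latticeNorm_lt {d : ℕ} (ρ : ℝ) : {n : Fin d → ℤ | latticeNorm n < ρ}.Finite := by
  obtain ⟨k, hk⟩ := pow_unbounded_of_one_lt ρ one_lt_two
  exact (dyadicBox d k).finite_toSet.subset fun n hn =>
    mem_dyadicBox.2 ((norm_le_latticeNorm n).trans (hn.trans hk).le)

/-! ### The comparison function and its failure to be square summable -/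

/-- The function `|n|^(-d/2) ∏ (log_i |n|)^(-1/2)`, cut off near the origin. -/
noncomputable def comparisonFun {d : ℕ} (s : ℕ) (r₀ : ℝ) (n : Fin d → ℤ) : ℝ :=
  if r₀ ≤ latticeNorm n then 1 / Real.sqrt (radialWeight d s (latticeNorm n)) else 0

theorem comparisonFun_nonneg {d s : ℕ} {r₀ : ℝ} (n : Fin d → ℤ) : 0 ≤ comparisonFun s r₀ n := by
  unfold comparisonFun
  split_ifs
  · positivity
  · exact le_rfl

theorem comparisonFun_sq {d s : ℕ} {r₀ : ℝ} (h : ∀ r, r₀ ≤ r → ∀ i ≤ s, 1 ≤ iterLog i r)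
    {n : Fin d → ℤ} (hn : r₀ ≤ latticeNorm n) :
    comparisonFun s r₀ n ^ 2 = 1 / radialWeight d s (latticeNorm n) := by
  rw [comparisonFun, if_pos hn, div_pow, one_pow,
    Real.sq_sqrt (zero_le_one.trans (one_le_radialWeight (h _ hn)))]

theorem comparisonFun_sq_mul_pow_le {d s : ℕ} {r₀ : ℝ}
    (h : ∀ r, r₀ ≤ r → ∀ i ≤ s, 1 ≤ iterLog i r) (n : Fin d → ℤ) :
    comparisonFun s r₀ n ^ 2 ≤ 1 ∧ comparisonFun s r₀ n ^ 2 * ‖n‖ ^ d ≤ 1 := by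
  by_cases hn : r₀ ≤ latticeNorm n
  · have h1 := one_le_radialWeight (d := d) (h _ hn)
    rw [comparisonFun_sq h hn, one_div_mul_eq_div]
    refine ⟨(div_le_one (zero_lt_one.trans_le h1)).2 h1,
      (div_le_one (zero_lt_one.trans_le h1)).2 ?_⟩
    exact (pow_le_pow_left₀ (norm_nonneg _) (norm_le_latticeNorm n) d).trans
      (pow_le_radialWeight (h _ hn))
  · simp [comparisonFun, hn]

/-- This identity turns the lower bound on `V` into the subsolution inequality for `comparisonFun`.
-/
theorem comparisonRatio_mul_comparisonFun {d s : ℕ} {r₀ : ℝ}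
    (h : ∀ r, r₀ ≤ r → ∀ i ≤ s, 1 ≤ iterLog i r) {n m : Fin d → ℤ}
    (hn : r₀ ≤ latticeNorm n) (hm : r₀ ≤ latticeNorm m) :
    comparisonRatio s n m * comparisonFun s r₀ n = comparisonFun s r₀ m := by
  have h1 := zero_lt_one.trans_le (one_le_radialWeight (d := d) (h _ hn))
  rw [comparisonRatio_eq_sqrt (h _ hn) (h _ hm), comparisonFun, comparisonFun, if_pos hn,
    if_pos hm, Real.sqrt_div h1.le, div_mul_div_comm, mul_one, mul_comm,
    div_mul_cancel_left₀ (Real.sqrt_pos.2 h1).ne', one_div]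

/-- The lattice points in a positive face of the cube of half-width `k`. -/
def facePoint {e : ℕ} (p : Σ k : ℕ, (Fin e → Fin k)) : Fin (e + 1) → ℤ :=
  Fin.cons (p.1 : ℤ) fun j => ((p.2 j : ℕ) : ℤ)

theorem facePoint_injective {e : ℕ} : Function.Injective (facePoint (e := e)) := by
  rintro ⟨k, y⟩ ⟨l, z⟩ h
  have h0 := congrFun h 0
  simp only [facePoint, Fin.cons_zero, Nat.cast_inj] at h0
  subst h0
  have h1 : y = z := by
    funext j
    have hj := congrFun h j.succ
    simp only [facePoint, Fin.cons_succ, Nat.cast_inj] at hj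
    exact Fin.ext hj
  rw [h1]

/-- One face of each cube suffices: its `k^(d-1)` points have norm at most `d k`, so their total
dominates a constant times the increment of `log_{s+1} (d k)`, and these increments telescope to
infinity. -/
theorem not_summable_comparisonFun_sq {d s : ℕ} (hd : 1 ≤ d) {r₀ : ℝ} (hr₀ : 1 ≤ r₀)
    (h : ∀ r, r₀ ≤ r → ∀ i ≤ s, 1 ≤ iterLog i r) :
    ¬ Summable fun n : Fin d → ℤ => comparisonFun s r₀ n ^ 2 := by
  obtain ⟨e, rfl⟩ : ∃ e, d = e + 1 := ⟨d - 1, by omega⟩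
  intro hsum
  have h1 := (hsum.comp_injective facePoint_injective).sigma
  simp only [Function.comp_def, tsum_fintype] at h1
  set b : ℕ → ℝ := fun k => ∑ y : Fin e → Fin k, comparisonFun s r₀ (facePoint ⟨k, y⟩) ^ 2 with hb
  obtain ⟨k₀, hk₀⟩ := exists_nat_ge r₀
  set D : ℝ := ((e + 1 : ℕ) : ℝ) with hD
  have hD1 : 1 ≤ D := by rw [hD]; exact_mod_cast Nat.le_add_left 1 e
  set a : ℕ → ℝ := fun k => iterLog (s + 1) (D * k) with ha
  have hstep : ∀ k, k₀ ≤ k → a (k + 1) - a k ≤ D ^ (e + 1) * b k := by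
    intro k hk
    have hkr : r₀ ≤ (k : ℝ) := hk₀.trans (by exact_mod_cast hk)
    have hkpos : (0 : ℝ) < k := by linarith
    have hDk : (k : ℝ) ≤ D * k := le_mul_of_one_le_left hkpos.le hD1
    have hDk' : D * (k : ℝ) ≤ D * ((k + 1 : ℕ) : ℝ) := by
      push_cast
      exact mul_le_mul_of_nonneg_left (by linarith) (by linarith)
    have hx := h (D * k) (hkr.trans hDk)
    have hy := h (D * (k + 1 : ℕ)) ((hkr.trans hDk).trans hDk')
    have hDpos : 0 < D * (k : ℝ) := by positivity
    have hprod : 0 < ∏ i ∈ Finset.Icc 1 s, iterLog i (D * k) :=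
      zero_lt_one.trans_le (one_le_prod_iterLog hx)
    have hbk : (k : ℝ) ^ e * (1 / radialWeight (e + 1) s (D * k)) ≤ b k := by
      have hc : ∑ y : Fin e → Fin k, 1 / radialWeight (e + 1) s (D * k) =
          (k : ℝ) ^ e * (1 / radialWeight (e + 1) s (D * k)) := by
        simp [Finset.sum_const, Finset.card_univ]
      rw [← hc]
      refine Finset.sum_le_sum fun y _ => ?_
      have hlow : (k : ℝ) ≤ latticeNorm (facePoint ⟨k, y⟩) := by
        have := abs_le_latticeNorm (facePoint ⟨k, y⟩) 0
        simpa [facePoint] using this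
      have hup : latticeNorm (facePoint ⟨k, y⟩) ≤ D * k := by
        refine latticeNorm_le_mul hkpos.le fun j => ?_
        refine Fin.cases ?_ (fun i => ?_) j
        · simp [facePoint]
        · simp only [facePoint, Fin.cons_succ, Int.cast_natCast, Nat.abs_cast]
          exact_mod_cast (y i).2.le
      have hn := hkr.trans hlow
      rw [comparisonFun_sq h hn]
      exact one_div_le_one_div_of_le (zero_lt_one.trans_le (one_le_radialWeight (h _ hn)))
        (radialWeight_le_radialWeight (h _ hn) hup)
    have hlog : Real.log (D * (k + 1 : ℕ)) - Real.log (D * k) ≤ 1 / k := by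
      refine (log_sub_log_le hDpos (hDpos.trans_le hDk')).trans_eq ?_
      have : D ≠ 0 := by positivity
      push_cast
      field_simp
      ring
    calc a (k + 1) - a k ≤ (Real.log (D * (k + 1 : ℕ)) - Real.log (D * k)) *
          ∏ i ∈ Finset.Icc 1 s, 1 / iterLog i (D * k) :=
          iterLog_succ_sub_le (fun i hi => zero_lt_one.trans_le (hx i hi))
            fun i hi => zero_lt_one.trans_le (hy i hi)
      _ ≤ 1 / k * (1 / ∏ i ∈ Finset.Icc 1 s, iterLog i (D * k)) := by
        rw [Finset.prod_div_distrib, Finset.prod_const_one]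
        exact mul_le_mul_of_nonneg_right hlog (by positivity)
      _ = D ^ (e + 1) * ((k : ℝ) ^ e * (1 / radialWeight (e + 1) s (D * k))) := by
        rw [radialWeight, mul_pow, pow_succ (k : ℝ) e]
        field_simp
      _ ≤ D ^ (e + 1) * b k := mul_le_mul_of_nonneg_left hbk (by positivity)
  have hb0 : ∀ k, 0 ≤ b k := fun k => Finset.sum_nonneg fun _ _ => sq_nonneg _
  have hbound : ∀ K, a (K + k₀) ≤ a k₀ + D ^ (e + 1) * ∑' k, b (k + k₀) := by
    intro K
    have hs := (summable_nat_add_iff k₀).2 h1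
    have h2 := hs.sum_le_tsum (Finset.range K) fun k _ => hb0 _
    have h3 : ∑ k ∈ Finset.range K, (a (k + 1 + k₀) - a (k + k₀)) ≤
        ∑ k ∈ Finset.range K, D ^ (e + 1) * b (k + k₀) :=
      Finset.sum_le_sum fun k _ => by
        rw [add_right_comm]
        exact hstep _ (Nat.le_add_left _ _)
    rw [Finset.sum_range_sub (fun k => a (k + k₀)), ← Finset.mul_sum, zero_add] at h3
    have h4 := mul_le_mul_of_nonneg_left h2 (show 0 ≤ D ^ (e + 1) by positivity)
    linarith
  have hlim : Tendsto (fun K => a (K + k₀)) atTop atTop :=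
    (tendsto_iterLog (s + 1)).comp <| (tendsto_natCast_atTop_atTop.const_mul_atTop
      (zero_lt_one.trans_le hD1)).comp (tendsto_add_atTop_nat k₀)
  obtain ⟨K, hK⟩ := (hlim.eventually_gt_atTop (a k₀ + D ^ (e + 1) * ∑' k, b (k + k₀))).exists
  exact absurd (hbound K) (not_le.2 hK)

/-! ### The criterion by comparison ratios -/

theorem not_top_eigenvalue_of_comparisonRatio {d : ℕ} (hd : 1 ≤ d) {V : (Fin d → ℤ) → ℝ} {s : ℕ}
    {N : ℝ} (hV : ∀ n : Fin d → ℤ, N ≤ latticeNorm n →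
      2 * (d : ℝ) - ∑ j : Fin d, (comparisonRatio s n (n + Pi.single j 1) +
        comparisonRatio s n (n - Pi.single j 1)) ≤ V n)
    (hp : ((4 * d : ℝ) : ℂ) ∈ (schrodinger V).pointSpectrum) :
    ¬ IsLUB {x : ℝ | (x : ℂ) ∈ (schrodinger V).spectrum} (4 * d : ℝ) := by
  intro hlub
  obtain ⟨ψ, hψ0, hψ⟩ := hp
  set v : (Fin d → ℤ) → ℝ := fun n => ‖(ψ : LatticeL2 d) n‖ with hv
  have hvW : ∀ n, neighborSum v n = (2 * d - V n) * v n :=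
    neighborSum_norm_eigenfunction hlub.1 hψ
  have hvpos : ∀ n, 0 < v n := by
    intro n
    refine (norm_nonneg _).lt_of_ne fun h => hψ0 ?_
    ext m
    exact norm_eq_zero.1 (eq_zero_of_neighborSum_eq (fun _ => norm_nonneg _) hvW h.symm m)
  obtain ⟨r₀, hr₀, hlog⟩ := exists_forall_one_le_iterLog s
  set φ : (Fin d → ℤ) → ℝ := comparisonFun s r₀ with hφ
  -- The margin `r₀ + 1` keeps all neighbours of points outside `A` in the region where `φ` is not
  -- cut off.
  set A : Set (Fin d → ℤ) := {n | latticeNorm n < max N (r₀ + 1)} with hA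
  have h0A : (0 : Fin d → ℤ) ∈ A := by
    have h0 : latticeNorm (0 : Fin d → ℤ) = 0 := by simp [latticeNorm]
    change latticeNorm (0 : Fin d → ℤ) < _
    rw [h0]
    exact lt_max_of_lt_right (by linarith)
  -- `A` is finite and `φ ≤ 1`, so the minimum `v a > 0` serves as the comparison constant.
  obtain ⟨a, -, ha⟩ := Set.exists_min_image A v (finite_latticeNorm_lt _) ⟨0, h0A⟩
  have hbound := comparisonFun_sq_mul_pow_le (d := d) hlog
  have hle := mul_le_of_subsolution hvpos hvW comparisonFun_nonneg (hvpos a).le h0A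
    (φ := φ) (fun n hn => (mul_le_of_le_one_right (hvpos a).le
      ((sq_le_one_iff₀ (comparisonFun_nonneg n)).1 (hbound n).1)).trans (ha n hn))
    (fun n hn => ?_) (χ := cutoff) finite_support_cutoff tendsto_cutoff
    (tendsto_cutoff_energy comparisonFun_nonneg (fun n => (hbound n).1) fun n => (hbound n).2)
  · refine not_summable_comparisonFun_sq hd hr₀ hlog ?_
    have hs : Summable fun n => v n ^ 2 := by
      have := (memℓp_gen_iff (p := 2) (by norm_num)).1 (lp.memℓp (ψ : LatticeL2 d))
      simpa using this
    refine Summable.of_nonneg_of_le (fun _ => sq_nonneg _) (fun n => ?_) (hs.mul_left (1 / v a ^ 2))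
    rw [one_div_mul_eq_div, le_div_iff₀ (pow_pos (hvpos a) 2), ← mul_pow, mul_comm]
    exact pow_le_pow_left₀ (mul_nonneg (hvpos a).le (comparisonFun_nonneg n)) (hle n) 2
  · have hn' : max N (r₀ + 1) ≤ latticeNorm n := not_lt.1 hn
    have hnr := (le_max_right _ _).trans hn'
    have hVn := hV n ((le_max_left _ _).trans hn')
    have hsum : neighborSum φ n = (∑ j : Fin d, (comparisonRatio s n (n + Pi.single j 1) +
        comparisonRatio s n (n - Pi.single j 1))) * φ n := by
      rw [Finset.sum_mul]
      refine Finset.sum_congr rfl fun j _ => ?_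
      have h1 := latticeNorm_sub_one_le_add_single n j
      have h2 := latticeNorm_sub_one_le_sub_single n j
      rw [add_mul, comparisonRatio_mul_comparisonFun hlog (by linarith) (by linarith),
        comparisonRatio_mul_comparisonFun hlog (by linarith) (by linarith)]
    rw [hsum]
    exact mul_le_mul_of_nonneg_right (by linarith) (comparisonFun_nonneg n)

/-! ### The explicit inverse square bound -/

/-- The third Taylor polynomial of `(1 + t) ^ (-a)` is a lower bound. -/
theorem taylor_cubic_le_rpow_neg {a t : ℝ} (ha : 0 ≤ a) (ht : -1 < t) :
    1 - a * t + a * (a + 1) / 2 * t ^ 2 - a * (a + 1) * (a + 2) / 6 * t ^ 3 ≤ (1 + t) ^ (-a) := by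
  set p : ℝ → ℝ := fun t =>
    1 - a * t + a * (a + 1) / 2 * t ^ 2 - a * (a + 1) * (a + 2) / 6 * t ^ 3 with hp
  set h : ℝ → ℝ := fun t => (1 + t) ^ a * p t with hh
  have hp' : ∀ t, HasDerivAt p
      (-a + a * (a + 1) * t - a * (a + 1) * (a + 2) / 2 * t ^ 2) t := by
    intro t
    have h0 := ((((hasDerivAt_id t).const_mul a).const_sub 1).add
      ((hasDerivAt_pow 2 t).const_mul (a * (a + 1) / 2))).sub
      ((hasDerivAt_pow 3 t).const_mul (a * (a + 1) * (a + 2) / 6))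
    refine h0.congr_deriv ?_
    push_cast
    ring
  -- All lower powers of `t` cancel. The derivative is a nonpositive factor times `t³`, so `h` is
  -- largest at `0`, where it equals `1`.
  have hh' : ∀ t, -1 < t → HasDerivAt h
      (-(a * (a + 1) * (a + 2) * (a + 3) / 6 * (1 + t) ^ (a - 1)) * t ^ 3) t := by
    intro t ht
    have ht' : 0 < 1 + t := by linarith
    have h1 : HasDerivAt (fun t : ℝ => (1 + t) ^ a) (1 * a * (1 + t) ^ (a - 1)) t :=
      ((hasDerivAt_id t).const_add 1).rpow_const (Or.inl ht'.ne')
    refine (h1.mul (hp' t)).congr_deriv ?_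
    have h2 : (1 + t) ^ a = (1 + t) ^ (a - 1) * (1 + t) := by
      rw [← Real.rpow_add_one ht'.ne', sub_add_cancel]
    rw [h2]
    simp only [hp]
    ring
  have hcont : ∀ t, -1 < t → ContinuousAt h t := fun t ht => (hh' t ht).continuousAt
  have hcoef : ∀ t, -1 < t → 0 ≤ a * (a + 1) * (a + 2) * (a + 3) / 6 * (1 + t) ^ (a - 1) :=
    fun t ht => mul_nonneg (by positivity) (Real.rpow_nonneg (by linarith) _)
  have h0 : h 0 = 1 := by simp [hh, hp]
  have hle : h t ≤ 1 := by
    rw [← h0]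
    rcases le_total 0 t with h0t | h0t
    · refine antitoneOn_of_deriv_nonpos (convex_Ici 0)
        (fun x hx => (hcont x ?_).continuousWithinAt)
        (fun x hx => (hh' x ?_).differentiableAt.differentiableWithinAt) (fun x hx => ?_)
        Set.self_mem_Ici (Set.mem_Ici.2 h0t) h0t
      · linarith [Set.mem_Ici.1 hx]
      · rw [interior_Ici] at hx
        linarith [Set.mem_Ioi.1 hx]
      · rw [interior_Ici] at hx
        have hx0 : 0 < x := Set.mem_Ioi.1 hx
        rw [(hh' x (by linarith)).deriv]
        exact mul_nonpos_of_nonpos_of_nonneg (neg_nonpos.2 (hcoef x (by linarith))) (by positivity)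
    · refine monotoneOn_of_deriv_nonneg (convex_Icc t 0)
        (fun x hx => (hcont x (ht.trans_le hx.1)).continuousWithinAt)
        (fun x hx => (hh' x ?_).differentiableAt.differentiableWithinAt) (fun x hx => ?_)
        (Set.left_mem_Icc.2 h0t) (Set.right_mem_Icc.2 h0t) h0t
      · rw [interior_Icc] at hx
        exact ht.trans hx.1
      · rw [interior_Icc] at hx
        rw [(hh' x (ht.trans hx.1)).deriv]
        exact mul_nonneg_of_nonpos_of_nonpos (neg_nonpos.2 (hcoef x (ht.trans hx.1)))
          (Odd.pow_nonpos (by decide) hx.2.le)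
  have ht' : 0 < 1 + t := by linarith
  rw [Real.rpow_neg ht'.le, ← one_div, le_div_iff₀ (Real.rpow_pos_of_pos ht' a), mul_comm]
  exact hle

/-- The sum `∑_{j ≤ s} ∏_{k ≤ j} 1 / log_k r`. -/
noncomputable def logSum (s : ℕ) (r : ℝ) : ℝ :=
  ∑ j ∈ Finset.Icc 1 s, ∏ k ∈ Finset.Icc 1 j, 1 / iterLog k r

theorem log_radialWeight {d s : ℕ} {r : ℝ} (h : ∀ i ≤ s, 1 ≤ iterLog i r) :
    Real.log (radialWeight d s r) =
      d * Real.log r + ∑ i ∈ Finset.Icc 1 s, iterLog (i + 1) r := by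
  have hr : 0 < r := zero_lt_one.trans_le (h 0 s.zero_le)
  rw [radialWeight, Real.log_mul (pow_pos hr d).ne'
    (zero_lt_one.trans_le (one_le_prod_iterLog h)).ne', Real.log_pow, Real.log_prod]
  · rfl
  · exact fun i hi => (zero_lt_one.trans_le (h i (Finset.mem_Icc.1 hi).2)).ne'

/-- By concavity, the logarithm of the weight as a function of `log r` lies below its tangent, of
slope `d + logSum s r`. The quarter combines the square root with the use of squared norms. -/
theorem rpow_le_comparisonRatio {d s : ℕ} {n m : Fin d → ℤ}
    (hn : ∀ i ≤ s, 1 ≤ iterLog i (latticeNorm n)) (hm : ∀ i ≤ s, 1 ≤ iterLog i (latticeNorm m)) :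
    (latticeNorm m ^ 2 / latticeNorm n ^ 2) ^ (-((d + logSum s (latticeNorm n)) / 4)) ≤
      comparisonRatio s n m := by
  have hn0 : 0 < latticeNorm n := zero_lt_one.trans_le (hn 0 s.zero_le)
  have hm0 : 0 < latticeNorm m := zero_lt_one.trans_le (hm 0 s.zero_le)
  have hwn := zero_lt_one.trans_le (one_le_radialWeight (d := d) hn)
  have hwm := zero_lt_one.trans_le (one_le_radialWeight (d := d) hm)
  have hdiff : Real.log (radialWeight d s (latticeNorm m)) -
      Real.log (radialWeight d s (latticeNorm n)) ≤
      (Real.log (latticeNorm m) - Real.log (latticeNorm n)) * (d + logSum s (latticeNorm n)) := by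
    have h : ∑ i ∈ Finset.Icc 1 s,
        (iterLog (i + 1) (latticeNorm m) - iterLog (i + 1) (latticeNorm n)) ≤
        (Real.log (latticeNorm m) - Real.log (latticeNorm n)) * logSum s (latticeNorm n) := by
      rw [logSum, Finset.mul_sum]
      refine Finset.sum_le_sum fun i hi => iterLog_succ_sub_le (fun k hk => ?_) fun k hk => ?_
      · exact zero_lt_one.trans_le (hn k (hk.trans (Finset.mem_Icc.1 hi).2))
      · exact zero_lt_one.trans_le (hm k (hk.trans (Finset.mem_Icc.1 hi).2))
    rw [Finset.sum_sub_distrib] at h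
    rw [log_radialWeight hn, log_radialWeight hm]
    linarith
  rw [comparisonRatio_eq_sqrt hn hm, Real.sqrt_eq_rpow,
    Real.rpow_def_of_pos (by positivity), Real.rpow_def_of_pos (div_pos hwn hwm),
    Real.log_div hwn.ne' hwm.ne', Real.log_div (by positivity) (by positivity),
    Real.log_pow, Real.log_pow]
  refine Real.exp_le_exp.2 ?_
  push_cast
  linarith

theorem latticeNorm_add_single_sq {d : ℕ} (n : Fin d → ℤ) (j : Fin d) (e : ℤ) (he : e ^ 2 = 1) :
    latticeNorm (n + e • Pi.single j 1) ^ 2 = latticeNorm n ^ 2 + (2 * e * n j + 1) := by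
  have he' : (e : ℝ) ^ 2 = 1 := by exact_mod_cast he
  rw [latticeNorm_sq, latticeNorm_sq, ← sub_eq_iff_eq_add', ← Finset.sum_sub_distrib,
    Finset.sum_eq_single j]
  · simp only [Pi.add_apply, Pi.smul_apply, Pi.single_eq_same, smul_eq_mul, mul_one, Int.cast_add]
    linear_combination he'
  · intro i _ hi
    simp [Pi.single_eq_of_ne hi]
  · simp

/-- Since `|n ± δ_j|² = ρ ± 2 n_j + 1`, odd powers of `n_j` cancel within each pair, and `∑ n_j² =
ρ` makes the total radial. -/
theorem cubic_le_sum_comparisonRatio {d s : ℕ} {r₀ : ℝ} (hr₀ : 1 ≤ r₀)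
    (h : ∀ r, r₀ ≤ r → ∀ i ≤ s, 1 ≤ iterLog i r) {n : Fin d → ℤ} (hn : r₀ + 1 ≤ latticeNorm n)
    {a ρ : ℝ} (ha : a = (d + logSum s (latticeNorm n)) / 4) (ha0 : 0 ≤ a)
    (hρ : ρ = latticeNorm n ^ 2) :
    2 * d - 2 * a * d / ρ + a * (a + 1) * (4 * ρ + d) / ρ ^ 2 -
        a * (a + 1) * (a + 2) * (12 * ρ + d) / (3 * ρ ^ 3) ≤
      ∑ j : Fin d, (comparisonRatio s n (n + Pi.single j 1) +
        comparisonRatio s n (n - Pi.single j 1)) := by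
  have hn0 : 0 < latticeNorm n := by linarith
  have hρ0 : 0 < ρ := hρ ▸ pow_pos hn0 2
  have hone : ∀ (m : Fin d → ℤ) (x : ℝ), r₀ ≤ latticeNorm m → latticeNorm m ^ 2 = ρ + x →
      1 - a * (x / ρ) + a * (a + 1) / 2 * (x / ρ) ^ 2 - a * (a + 1) * (a + 2) / 6 * (x / ρ) ^ 3 ≤
        comparisonRatio s n m := by
    intro m x hm hx
    have hm0 : 0 < latticeNorm m := by linarith
    have hsplit : latticeNorm m ^ 2 / latticeNorm n ^ 2 = 1 + x / ρ := by
      rw [hx, ← hρ, add_div, div_self hρ0.ne']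
    have hpos : 0 < 1 + x / ρ := hsplit ▸ by positivity
    have h1 := rpow_le_comparisonRatio (h _ (by linarith : r₀ ≤ latticeNorm n)) (h _ hm)
    rw [hsplit, ← ha] at h1
    exact (taylor_cubic_le_rpow_neg ha0 (by linarith)).trans h1
  have hterm : ∀ j : Fin d, 2 - 2 * a / ρ + a * (a + 1) * (4 * (n j : ℝ) ^ 2 + 1) / ρ ^ 2 -
      a * (a + 1) * (a + 2) * (12 * (n j : ℝ) ^ 2 + 1) / (3 * ρ ^ 3) ≤
      comparisonRatio s n (n + Pi.single j 1) + comparisonRatio s n (n - Pi.single j 1) := by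
    intro j
    have e1 := latticeNorm_add_single_sq n j 1 (by norm_num)
    have e2 := latticeNorm_add_single_sq n j (-1) (by norm_num)
    rw [one_smul, ← hρ] at e1
    rw [neg_smul, one_smul, ← sub_eq_add_neg, ← hρ] at e2
    have h1 := hone _ _ (by linarith [latticeNorm_sub_one_le_add_single n j]) e1
    have h2 := hone _ _ (by linarith [latticeNorm_sub_one_le_sub_single n j]) e2
    refine le_trans (le_of_eq ?_) (add_le_add h1 h2)
    push_cast
    field_simp
    ring
  refine le_trans (le_of_eq ?_) (Finset.sum_le_sum fun j _ => hterm j)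
  simp only [Finset.sum_sub_distrib, Finset.sum_add_distrib, ← Finset.sum_div, ← Finset.mul_sum,
    ← latticeNorm_sq, ← hρ, Finset.sum_const, Finset.card_univ, Fintype.card_fin, nsmul_eq_mul]
  ring

theorem logSum_succ (s : ℕ) (r : ℝ) :
    logSum (s + 1) r = logSum s r + ∏ k ∈ Finset.Icc 1 (s + 1), 1 / iterLog k r :=
  Finset.sum_Icc_succ_top (Nat.le_add_left 1 s) _

theorem prod_one_div_iterLog_mem {s j : ℕ} {r : ℝ} (h : ∀ i ≤ s, 1 ≤ iterLog i r) (hj : j ≤ s) :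
    0 ≤ ∏ k ∈ Finset.Icc 1 j, 1 / iterLog k r ∧ ∏ k ∈ Finset.Icc 1 j, 1 / iterLog k r ≤ 1 := by
  have h1 : ∀ k ∈ Finset.Icc 1 j, 1 ≤ iterLog k r := fun k hk =>
    h k ((Finset.mem_Icc.1 hk).2.trans hj)
  exact ⟨Finset.prod_nonneg fun k hk => one_div_nonneg.2 (zero_le_one.trans (h1 k hk)),
    Finset.prod_le_one (fun k hk => one_div_nonneg.2 (zero_le_one.trans (h1 k hk)))
      fun k hk => (div_le_one (zero_lt_one.trans_le (h1 k hk))).2 (h1 k hk)⟩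

theorem logSum_le {s : ℕ} {r : ℝ} (h : ∀ i ≤ s, 1 ≤ iterLog i r) : logSum s r ≤ s := by
  calc logSum s r ≤ ∑ _j ∈ Finset.Icc 1 s, (1 : ℝ) :=
        Finset.sum_le_sum fun j hj => (prod_one_div_iterLog_mem h (Finset.mem_Icc.1 hj).2).2
    _ = s := by simp

theorem one_div_log_le_logSum {s : ℕ} {r : ℝ} (h : ∀ i ≤ s + 1, 1 ≤ iterLog i r) :
    1 / Real.log r ≤ logSum (s + 1) r := by
  have h1 := Finset.single_le_sum (f := fun j => ∏ k ∈ Finset.Icc 1 j, 1 / iterLog k r)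
    (fun j hj => (prod_one_div_iterLog_mem h (Finset.mem_Icc.1 hj).2).1)
    (Finset.mem_Icc.2 ⟨le_rfl, Nat.le_add_left 1 s⟩)
  simpa [iterLog, logSum] using h1

theorem exists_forall_mul_log_le (C : ℝ) : ∃ r₁ : ℝ, ∀ r, r₁ ≤ r → C * Real.log r ≤ r := by
  have h := Real.isLittleO_log_id_atTop.bound (show 0 < 1 / (|C| + 1) by positivity)
  obtain ⟨r₁, hr₁⟩ := eventually_atTop.1 h
  refine ⟨max r₁ 1, fun r hr => ?_⟩
  have h1 := hr₁ r ((le_max_left _ _).trans hr)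
  have hr1 : 1 ≤ r := (le_max_right _ _).trans hr
  rw [id, Real.norm_of_nonneg (Real.log_nonneg hr1), Real.norm_of_nonneg (by linarith),
    one_div_mul_eq_div, le_div_iff₀ (by positivity)] at h1
  nlinarith [Real.log_nonneg hr1, le_abs_self C]

/-- The explicit inverse square type bound implies the bound by comparison ratios. -/
theorem exists_sub_sum_comparisonRatio_le (d s : ℕ) :
    ∃ N : ℝ, ∀ n : Fin d → ℤ, N ≤ latticeNorm n →
      2 * (d : ℝ) - ∑ j : Fin d, (comparisonRatio (s + 1) n (n + Pi.single j 1) +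
        comparisonRatio (s + 1) n (n - Pi.single j 1)) ≤
      -((d : ℝ) * (4 - (d : ℝ)) / (4 * latticeNorm n ^ 2)) -
        1 / latticeNorm n ^ 2 * logSum s (latticeNorm n) := by
  -- The additional logarithm guarantees `S ≥ 1 / log r` below, even when `s = 0`.
  obtain ⟨r₀, hr₀, hlog⟩ := exists_forall_one_le_iterLog (s + 1)
  set b : ℝ := (d + (s + 1 : ℕ)) / 4 with hb
  -- As `a ≤ b` and `ρ ≥ 1`, the cubic term is at most `C / ρ²`.
  set C : ℝ := b * (b + 1) * (b + 2) * (12 + d) / 3 with hC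
  have hb0 : 0 ≤ b := by positivity
  have hC0 : 0 ≤ C := by positivity
  obtain ⟨r₁, hr₁⟩ := exists_forall_mul_log_le (2 * (C + 1))
  refine ⟨max (r₀ + 1) r₁, fun n hn => ?_⟩
  have hn0 : r₀ + 1 ≤ latticeNorm n := (le_max_left _ _).trans hn
  have hL := hr₁ _ ((le_max_right _ _).trans hn)
  have hlogn := hlog (latticeNorm n) (by linarith)
  set r := latticeNorm n with hr
  have hl1 : 1 ≤ Real.log r := hlogn 1 (Nat.le_add_left 1 s)
  set S := logSum (s + 1) r with hS
  have hS1 : 1 / Real.log r ≤ S := one_div_log_le_logSum hlogn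
  have hS0 : 0 ≤ S := (by positivity : (0 : ℝ) ≤ 1 / Real.log r).trans hS1
  have hS2 : S ≤ (s + 1 : ℕ) := logSum_le hlogn
  have hS3 : logSum s r ≤ S := by
    rw [hS, logSum_succ]
    linarith [(prod_one_div_iterLog_mem hlogn le_rfl).1]
  set a : ℝ := (d + S) / 4 with ha
  have ha0 : 0 ≤ a := by positivity
  have hab : a ≤ b := by
    rw [ha, hb]
    linarith
  have hρ1 : 1 ≤ r ^ 2 := one_le_pow₀ (by linarith)
  have key := cubic_le_sum_comparisonRatio (d := d) hr₀ hlog (n := n) hn0 ha ha0 rfl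
  rw [← hr] at key
  set ρ := r ^ 2 with hρ
  have hρ0 : 0 < ρ := by linarith
  -- From `2 (C + 1) ≤ r / log r ≤ r S`, squaring gives `S² ρ / 4 ≥ (C + 1)² ≥ C`.
  have hCρ : C ≤ S ^ 2 / 4 * ρ := by
    have h1 : 2 * (C + 1) ≤ r * S := by
      have h2 : 2 * (C + 1) ≤ r / Real.log r := (le_div_iff₀ (by linarith)).2 hL
      refine h2.trans ?_
      rw [div_eq_mul_one_div]
      exact mul_le_mul_of_nonneg_left hS1 (by linarith)
    have h2 : (2 * (C + 1)) ^ 2 ≤ (r * S) ^ 2 := pow_le_pow_left₀ (by positivity) h1 2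
    rw [mul_pow r S, ← hρ] at h2
    nlinarith
  have hcube : a * (a + 1) * (a + 2) * (12 * ρ + d) / (3 * ρ ^ 3) ≤ S ^ 2 / 4 / ρ := by
    have h1 : a * (a + 1) * (a + 2) * (12 * ρ + d) ≤ 3 * C * ρ := by
      have h2 : a * (a + 1) * (a + 2) ≤ b * (b + 1) * (b + 2) := by gcongr
      have h3 : 12 * ρ + (d : ℝ) ≤ (12 + d) * ρ := by
        nlinarith [(Nat.cast_nonneg d : (0 : ℝ) ≤ d)]
      calc _ ≤ b * (b + 1) * (b + 2) * ((12 + d) * ρ) :=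
            mul_le_mul h2 h3 (by positivity) (by positivity)
        _ = 3 * C * ρ := by rw [hC]; ring
    rw [div_le_div_iff₀ (by positivity) hρ0]
    calc _ ≤ 3 * C * ρ * ρ := mul_le_mul_of_nonneg_right h1 hρ0.le
      _ ≤ 3 * (S ^ 2 / 4 * ρ) * ρ * ρ := by
        have : 3 * C * ρ * ρ = 3 * C * (ρ * ρ) := by ring
        rw [this, mul_assoc _ ρ ρ]
        exact mul_le_mul_of_nonneg_right (by linarith) (by positivity)
      _ = _ := by ring
  have hquad : a * (a + 1) * 4 / ρ ≤ a * (a + 1) * (4 * ρ + d) / ρ ^ 2 := by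
    rw [div_le_div_iff₀ hρ0 (by positivity)]
    have : 0 ≤ a * (a + 1) * d * ρ := by positivity
    nlinarith
  -- With `a = (d + S) / 4` the terms of order `1 / ρ` produce the required bound plus `S² / (4 ρ)`,
  -- exactly the surplus spent on the cubic term.
  have hmain : -(2 * a * d / ρ) + a * (a + 1) * 4 / ρ - S ^ 2 / 4 / ρ =
      d * (4 - d) / (4 * ρ) + 1 / ρ * S := by
    rw [ha]
    field_simp
    ring
  have hlast : 1 / ρ * logSum s r ≤ 1 / ρ * S :=
    mul_le_mul_of_nonneg_left hS3 (by positivity)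
  linarith

theorem theorem3p2 (d : ℕ) (hd : 1 ≤ d) (V : (Fin d → ℤ) → ℝ) :
    ((∃ s : ℕ, ∃ N : ℝ, ∀ n : Fin d → ℤ, N ≤ latticeNorm n →
        2 * (d : ℝ) - ∑ j : Fin d, (comparisonRatio s n (n + Pi.single j 1) +
          comparisonRatio s n (n - Pi.single j 1)) ≤ V n) →
      ((4 * d : ℝ) : ℂ) ∉ (schrodinger V).pointSpectrum ∨
        ¬ IsLUB {x : ℝ | (x : ℂ) ∈ (schrodinger V).spectrum} (4 * d : ℝ)) ∧
    ((∃ s : ℕ, ∃ N : ℝ, ∀ n : Fin d → ℤ, N ≤ latticeNorm n →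
        -((d : ℝ) * (4 - (d : ℝ)) / (4 * latticeNorm n ^ 2)) -
          1 / latticeNorm n ^ 2 *
            ∑ j ∈ Finset.Icc 1 s, ∏ k ∈ Finset.Icc 1 j, 1 / iterLog k (latticeNorm n) ≤ V n) →
      ((4 * d : ℝ) : ℂ) ∉ (schrodinger V).pointSpectrum ∨
        ¬ IsLUB {x : ℝ | (x : ℂ) ∈ (schrodinger V).spectrum} (4 * d : ℝ)) := by
  refine ⟨?_, ?_⟩
  · rintro ⟨s, N, hV⟩
    exact or_iff_not_imp_left.2 fun h =>
      not_top_eigenvalue_of_comparisonRatio hd hV (not_not.1 h)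
  · rintro ⟨s, N, hV⟩
    obtain ⟨N', hN'⟩ := exists_sub_sum_comparisonRatio_le d s
    exact or_iff_not_imp_left.2 fun h =>
      not_top_eigenvalue_of_comparisonRatio hd (N := max N N') (fun n hn =>
        (hN' n ((le_max_right _ _).trans hn)).trans (hV n ((le_max_left _ _).trans hn)))
        (not_not.1 h)
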